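/- Let $d\ge 1$. Let $B=(B_t)_{t\ge 0}$ be Brownian motion in $\mathbb R^d$ started at $0$ with transition density $(4\pi t)^{-d/2}e^{-|x|^2/(4t)}$, and let $T=(T_t)_{t\ge0}$ be a subordinator (a non-decreasing Lévy process with values in $[0,\infty)$), independent of $B$, with Laplace exponent $\varphi:(0,\infty)\to(0,\infty)$, i.e. $\mathbb E\,e^{-\lambda T_t}=e^{-t\varphi(\lambda)}$ for all $\lambda>0$, $t\ge 0$. Put $X_t=B_{T_t}$, $H(\lambda)=\varphi(\lambda)-\lambda\varphi'(\lambda)$, and $$p(t,x)=\int_{(0,\infty)}(4\pi s)^{-d/2}e^{-|x|^2/(4s)}\,\mathbb P(T_t\in ds).$$ A function $\ell:(0,\infty)\to(0,\infty)$ varies regularly at $0$ (at $\infty$) with index $\gamma$ if $\ell(c\lambda)/\ell(\lambda)\to c^\gamma$ as $\lambda\to0$ ($\lambda\to\infty$) for every $c>0$. The subordinator has no drift if $\varphi(\lambda)=\int_{(0,\infty)}(1-e^{-\lambda s})\,\nu(ds)$ for a measure $\nu$ on $(0,\infty)$ with $\int(1\wedge s)\,\nu(ds)<\infty$. All limits below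 are joint limits in $(t,x)$ with $t>0$ and $x\ne0$. (0) For every $t>0$, $p(t,\cdot)$ is the transition density of $X$, in the sense that $\mathbb P(X_t\in dx)=\mathbb P(T_t=0)\,\delta_0(dx)+p(t,x)\,dx$. (i) If $\varphi$ varies regularly at $0$ (at $\infty$, respectively) with index $\gamma\in[0,1)$, then $$\frac{p(t,x)}{t|x|^{-d}\varphi(|x|^{-2})}\longrightarrow \gamma4^\gamma\pi^{-d/2}\frac{\Gamma(\frac d2+\gamma)}{\Gamma(1-\gamma)}$$ as $|x|\to\infty$ ($|x|\to0$, respectively) and $t\varphi(|x|^{-2})\to0$. Moreover this constant equals $\gamma4^\gamma\pi^{-d/2-1}\sin(\gamma\pi)\Gamma(\gamma)\Gamma(\frac d2+\gamma)$ (read as $0$ when $\gamma=0$). (ii) Suppose that $H$ varies regularly at $0$ (at $\infty$, respectively) with index $\gamma\in[0,2)$; if $H$ varies regularly at $\infty$ with index $\gamma\in[0,1)$, suppose in addition that $T$ has no drift. Then $$\frac{p(t,x)}{t|x|^{-d}H(|x|^{-2})}\longrightarrow\gamma4^\gamma\pi^{-d/2}\frac{\Gamma(\frac d2+\gamma)}{\Gamma(2-\gamma)}$$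 as $|x|\to\infty$ ($|x|\to0$, respectively) and $t\varphi(|x|^{-2})^2/H(|x|^{-2})\to0$. -/

import Mathlib

open MeasureTheory ProbabilityTheory Filter Topology Set
open scoped NNReal ENNReal

noncomputable section

namespace SubordinateBM

/-- `f` is a positive function on `(0, ∞)` which varies regularly along the filter `a`
(`𝓝[>] 0` for regular variation at zero, `atTop` for regular variation at infinity)
with index `α`. -/
def VariesRegularly (f : ℝ → ℝ) (a : Filter ℝ) (α : ℝ) : Prop :=
  (∀ l : ℝ, 0 < l → 0 < f l) ∧
    ∀ c : ℝ, 0 < c → Tendsto (fun l : ℝ => f (c * l) / f l) a (𝓝 (c ^ α))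

/-- The function `(4πs)^{-d/2} exp(-|x|² / (4s))` on `ℝᵈ`. -/
def heatKernel {d : ℕ} (s : ℝ) (x : EuclideanSpace ℝ (Fin d)) : ℝ :=
  (4 * Real.pi * s) ^ (-(d : ℝ) / 2) * Real.exp (-‖x‖ ^ 2 / (4 * s))

/-- `d`-dimensional Brownian motion started at the origin and run at twice the usual speed, so
that its transition density is `heatKernel`. -/
structure IsBrownianMotion {d : ℕ} {Ω : Type*} [MeasurableSpace Ω]
    (B : ℝ≥0 → Ω → EuclideanSpace ℝ (Fin d)) (P : Measure Ω) : Prop where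
  measurable : ∀ t, Measurable (B t)
  zero : ∀ᵐ ω ∂P, B 0 ω = 0
  indepIncrements : HasIndepIncrements B P
  law : ∀ s t : ℝ≥0, s < t →
    P.map (fun ω => B t ω - B s ω) =
      volume.withDensity (fun x => ENNReal.ofReal (heatKernel ((t : ℝ) - s) x))
  continuous_paths : ∀ᵐ ω ∂P, Continuous (fun t => B t ω)

/-- A subordinator: a non-decreasing Lévy process with values in `[0, ∞)`. (For non-decreasing
paths, right-continuity is the càdlàg property.) -/
structure IsSubordinator {Ω : Type*} [MeasurableSpace Ω]
    (T : ℝ≥0 → Ω → ℝ≥0) (P : Measure Ω) : Prop where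
  measurable : ∀ t, Measurable (T t)
  zero : ∀ᵐ ω ∂P, T 0 ω = 0
  indepIncrements : HasIndepIncrements (fun t ω => (T t ω : ℝ)) P
  stationary : ∀ s t : ℝ≥0,
    P.map (fun ω => (T (s + t) ω : ℝ) - (T s ω : ℝ)) = P.map (fun ω => (T t ω : ℝ))
  mono_paths : ∀ᵐ ω ∂P, Monotone (fun t => T t ω)
  rightContinuous_paths : ∀ᵐ ω ∂P, ∀ t, ContinuousWithinAt (fun s => T s ω) (Ici t) t

/-- `φ : (0, ∞) → (0, ∞)` is the Laplace exponent of the process `T`. -/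
def IsLaplaceExponent {Ω : Type*} [MeasurableSpace Ω] (φ : ℝ → ℝ)
    (T : ℝ≥0 → Ω → ℝ≥0) (P : Measure Ω) : Prop :=
  ∀ l : ℝ, 0 < l → 0 < φ l ∧
    ∀ t : ℝ≥0, ∫ ω, Real.exp (-l * (T t ω : ℝ)) ∂P = Real.exp (-(t : ℝ) * φ l)

/-- `φ(l) = b l + ∫_{(0,∞)} (1 - e^{-l s}) ν(ds)` with `b ≥ 0` (the drift) and `ν` a measure on
`(0, ∞)` with `∫ (1 ∧ s) ν(ds) < ∞` (the Lévy measure). -/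
def IsLevyKhintchinePair (φ : ℝ → ℝ) (b : ℝ) (ν : Measure ℝ) : Prop :=
  0 ≤ b ∧ ν (Iic 0) = 0 ∧ ∫⁻ s, ENNReal.ofReal (min 1 s) ∂ν < ∞ ∧
    ∀ l : ℝ, 0 < l → φ l = b * l + ∫ s, (1 - Real.exp (-l * s)) ∂ν

/-- The drift in the Lévy–Khintchine representation of `φ` is zero. -/
def HasNoDrift (φ : ℝ → ℝ) : Prop :=
  ∃ ν : Measure ℝ, IsLevyKhintchinePair φ 0 ν

/-- The subordinate process `X_t = B_{T_t}`. -/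
def subordinate {d : ℕ} {Ω : Type*} (B : ℝ≥0 → Ω → EuclideanSpace ℝ (Fin d))
    (T : ℝ≥0 → Ω → ℝ≥0) (t : ℝ≥0) (ω : Ω) : EuclideanSpace ℝ (Fin d) :=
  B (T t ω) ω

/-- `p(t, x) = ∫_{(0,∞)} (4πs)^{-d/2} exp(-|x|² / (4s)) P(T_t ∈ ds)`. -/
def transitionDensity {d : ℕ} {Ω : Type*} [MeasurableSpace Ω]
    (T : ℝ≥0 → Ω → ℝ≥0) (P : Measure Ω) (t : ℝ≥0) (x : EuclideanSpace ℝ (Fin d)) : ℝ :=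
  ∫ s in Ioi (0 : ℝ≥0), heatKernel (s : ℝ) x ∂(P.map (T t))

/-- `H(l) = φ(l) - l φ'(l)`. -/
def lowerFunction (φ : ℝ → ℝ) (l : ℝ) : ℝ := φ l - l * deriv φ l

/-- The filter on pairs `(t, x)`, `t > 0`, describing the double limit in which `|x|` tends along
`a` (`atTop` for `|x| → ∞`, `𝓝[>] 0` for `|x| → 0`, `x ≠ 0`) and, jointly, `h(t, x) → 0`. -/
def jointLimit {d : ℕ} (a : Filter ℝ) (h : ℝ≥0 → EuclideanSpace ℝ (Fin d) → ℝ) :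
    Filter (ℝ≥0 × EuclideanSpace ℝ (Fin d)) :=
  comap (fun q => ‖q.2‖) a ⊓ comap (fun q => h q.1 q.2) (𝓝 0) ⊓ 𝓟 {q | 0 < q.1}

end SubordinateBM

end

namespace SubordinateBM

/-! Write λ = |x|⁻² and let k be the heat kernel at distance one (`scaledKernel`). Brownian scaling
gives p(t,x) = |x|^{-d} E k(λT_t), so the asymptotics concern the finite measures M = law(λT_t) / (t
N(λ)), with N = φ in (i) and N = H in (ii). The argument is a Tauberian theorem for these measures,
applied directly along the joint limit.

The test function is r(y) = 1 - e^{-y} - y e^{-y} (`expRemainder`), for which E r(lT_t) = r(tφ(l)) +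
t H(l) e^{-tφ(l)} exactly (`IsLaplaceExponent.integral_expRemainder`). In (ii) the first term is at
most (tφ)², negligible against tH when tφ²/H → 0, so regular variation of H yields ∫ r(cu) M(du) →
c^γ. In (i) one starts from ∫ (1 - e^{-cu}) M(du) → c^γ and differentiates in c to reach the limit
(1-γ) c^γ.

From ∫ r(cu) M(du) → κ c^γ, differentiation in c gives ∫ u² e^{-au} M(du) → κγ a^{γ-2}, the Laplace
transform of κγ/Γ(2-γ) u^{1-γ} du (`tendsto_integral_sq_mul_exp_neg`). Weierstrass approximation in
the variable e^{-u} (`tendsto_integral_comp_exp_neg`) extends this to k(u) e^{-εu}, and a bound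
uniform along the filter lets ε → 0 (`tendsto_integral_scaledKernel`). The limit is κγ/Γ(2-γ) ∫ k(u)
u^{-1-γ} du, a Gamma integral.

The law of B_{T_t} in (0) follows by discretizing T_t, using independence for countably many values,
and passing to the limit with path continuity. -/

/-! ### Limits of derivatives, approximation, and Weierstrass in the variable e^{-u} -/

/-- This is the monotone density argument. Here w(c) Ψ(c) plays the role of the derivative of A, and
the two-sided increment bounds squeeze Ψ(a) between difference quotients of A on either side of a,
so pointwise convergence of A passes to its derivative. -/
theorem tendsto_of_increment_bounds {ι : Type*} {l : Filter ι} {A Ψ : ι → ℝ → ℝ}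
    {A₀ w : ℝ → ℝ} {a D : ℝ} (ha : 0 < a) (hw : ContinuousAt w a) (hwa : 0 < w a)
    (hD : HasDerivAt A₀ D a) (hA : ∀ c, 0 < c → Tendsto (fun i => A i c) l (𝓝 (A₀ c)))
    (hinc : ∀ i c c', 0 < c → c < c' → w c * (c' - c) * Ψ i c' ≤ A i c' - A i c ∧
      A i c' - A i c ≤ w c' * (c' - c) * Ψ i c) :
    Tendsto (fun i => Ψ i a) l (𝓝 (D / w a)) := by
  have hlim : Tendsto (fun c => slope A₀ a c / w c) (𝓝[≠] a) (𝓝 (D / w a)) :=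
    hD.tendsto_slope.div (hw.tendsto.mono_left nhdsWithin_le_nhds) hwa.ne'
  have hpos : ∀ᶠ c in 𝓝 a, 0 < w c ∧ 0 < c :=
    (hw.eventually (lt_mem_nhds hwa)).and (lt_mem_nhds ha)
  refine tendsto_order.2 ⟨fun b hb => ?_, fun b hb => ?_⟩
  -- Points c to the right of a bound Ψ(a) from below, points to the left bound it from above. In
  -- each case c is fixed before the limit along `l`.
  · have h1 : ∀ᶠ c in 𝓝[>] a, b < slope A₀ a c / w c ∧ (0 < w c ∧ 0 < c) ∧ a < c :=
      ((hlim.mono_left (nhdsWithin_mono a fun _ hx => ne_of_gt hx)).eventually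
        (lt_mem_nhds hb)).and ((hpos.filter_mono nhdsWithin_le_nhds).and self_mem_nhdsWithin)
    obtain ⟨c, hbc, ⟨hwc, hc⟩, hac⟩ := h1.exists
    have h2 : Tendsto (fun i => (A i c - A i a) / (c - a) / w c) l
        (𝓝 (slope A₀ a c / w c)) := by
      rw [slope_def_field]
      exact (((hA c hc).sub (hA a ha)).div_const _).div_const _
    filter_upwards [h2.eventually (lt_mem_nhds hbc)] with i hi
    refine hi.trans_le ?_
    have h3 : 0 < c - a := sub_pos.2 hac
    rw [div_div, div_le_iff₀ (by positivity)]
    linarith [(hinc i a c ha hac).2]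
  · have h1 : ∀ᶠ c in 𝓝[<] a, slope A₀ a c / w c < b ∧ (0 < w c ∧ 0 < c) ∧ c < a :=
      ((hlim.mono_left (nhdsWithin_mono a fun _ hx => ne_of_lt hx)).eventually
        (gt_mem_nhds hb)).and ((hpos.filter_mono nhdsWithin_le_nhds).and self_mem_nhdsWithin)
    obtain ⟨c, hbc, ⟨hwc, hc⟩, hac⟩ := h1.exists
    have h2 : Tendsto (fun i => (A i a - A i c) / (a - c) / w c) l
        (𝓝 (slope A₀ a c / w c)) := by
      rw [slope_comm, slope_def_field]
      exact (((hA a ha).sub (hA c hc)).div_const _).div_const _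
    filter_upwards [h2.eventually (gt_mem_nhds hbc)] with i hi
    refine lt_of_le_of_lt ?_ hi
    have h3 : 0 < a - c := sub_pos.2 hac
    rw [div_div, le_div_iff₀ (by positivity)]
    linarith [(hinc i c a hc hac).1]

theorem tendsto_of_approximation {ι : Type*} {l : Filter ι} {F : ι → ℝ} {Fε : ℝ → ι → ℝ}
    {δ J : ℝ → ℝ} {J₀ : ℝ} (hF : ∀ ε, 0 < ε → Tendsto (Fε ε) l (𝓝 (J ε)))
    (hδ : ∀ ε, 0 < ε → ∀ᶠ i in l, |F i - Fε ε i| ≤ δ ε)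
    (hδ0 : Tendsto δ (𝓝[>] 0) (𝓝 0)) (hJ : Tendsto J (𝓝[>] 0) (𝓝 J₀)) :
    Tendsto F l (𝓝 J₀) := by
  rw [Metric.tendsto_nhds]
  intro η hη
  have h1 : ∀ᶠ ε : ℝ in 𝓝[>] 0, δ ε < η / 3 ∧ dist (J ε) J₀ < η / 3 ∧ 0 < ε :=
    (hδ0.eventually (gt_mem_nhds (by positivity))).and
      ((Metric.tendsto_nhds.1 hJ _ (by positivity)).and self_mem_nhdsWithin)
  obtain ⟨ε, h2, h3, hε⟩ := h1.exists
  filter_upwards [hδ ε hε, Metric.tendsto_nhds.1 (hF ε hε) (η / 3) (by positivity)] with i h4 h5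
  rw [Real.dist_eq, abs_lt] at *
  rw [abs_le] at h4
  constructor <;> linarith

/-- If weighted measures on the half-line converge when tested against all powers of `exp (-u)`,
they converge when tested against continuous functions of `exp (-u)`. -/
theorem tendsto_integral_comp_exp_neg {ι : Type*} {l : Filter ι} {M : ι → Measure ℝ}
    {M₀ : Measure ℝ} {w w₀ : ℝ → ℝ}
    (hM : ∀ i, ∀ᵐ u ∂M i, 0 ≤ u ∧ 0 ≤ w u) (hM₀ : ∀ᵐ u ∂M₀, 0 ≤ u ∧ 0 ≤ w₀ u)
    (hw : ∀ i, Integrable w (M i)) (hw₀ : Integrable w₀ M₀)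
    (hlim : ∀ k : ℕ, Tendsto (fun i => ∫ u, Real.exp (-u) ^ k * w u ∂M i) l
      (𝓝 (∫ u, Real.exp (-u) ^ k * w₀ u ∂M₀)))
    {G : ℝ → ℝ} (hG : ContinuousOn G (Icc 0 1)) (hGm : Measurable G) :
    Tendsto (fun i => ∫ u, G (Real.exp (-u)) * w u ∂M i) l
      (𝓝 (∫ u, G (Real.exp (-u)) * w₀ u ∂M₀)) := by
  have hmem : ∀ u : ℝ, 0 ≤ u → Real.exp (-u) ∈ Icc (0 : ℝ) 1 := fun u hu =>
    ⟨(Real.exp_pos _).le, Real.exp_le_one_iff.2 (by linarith)⟩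
  have key : ∀ (m : Measure ℝ) (v : ℝ → ℝ), (∀ᵐ u ∂m, 0 ≤ u ∧ 0 ≤ v u) → Integrable v m →
      ∀ (g : ℝ → ℝ), Measurable g → ContinuousOn g (Icc 0 1) →
      Integrable (fun u => g (Real.exp (-u)) * v u) m := by
    intro m v h0 hv g hgm hg
    obtain ⟨C, hC⟩ := isCompact_Icc.exists_bound_of_continuousOn hg
    refine hv.bdd_mul (c := C) (hgm.comp (by fun_prop)).aestronglyMeasurable ?_
    filter_upwards [h0] with u hu using hC _ (hmem u hu.1)
  have poly : ∀ (m : Measure ℝ) (v : ℝ → ℝ), (∀ᵐ u ∂m, 0 ≤ u ∧ 0 ≤ v u) → Integrable v m →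
      ∀ q : Polynomial ℝ, ∫ u, q.eval (Real.exp (-u)) * v u ∂m =
        ∑ k ∈ Finset.range (q.natDegree + 1),
          q.coeff k * ∫ u, Real.exp (-u) ^ k * v u ∂m := by
    intro m v h0 hv q
    simp_rw [Polynomial.eval_eq_sum_range, Finset.sum_mul, mul_assoc]
    rw [integral_finsetSum]
    · simp_rw [integral_const_mul]
    · intro k _
      exact (key m v h0 hv (fun y => y ^ k) (by fun_prop) (by fun_prop)).const_mul _
  have diff : ∀ (m : Measure ℝ) (v : ℝ → ℝ), (∀ᵐ u ∂m, 0 ≤ u ∧ 0 ≤ v u) → Integrable v m →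
      ∀ (q : Polynomial ℝ) (η : ℝ), (∀ y ∈ Icc (0 : ℝ) 1, |q.eval y - G y| < η) →
      |∫ u, G (Real.exp (-u)) * v u ∂m - ∫ u, q.eval (Real.exp (-u)) * v u ∂m| ≤
        η * ∫ u, v u ∂m := by
    intro m v h0 hv q η hq
    rw [← integral_sub (key m v h0 hv G hGm hG)
      (key m v h0 hv (fun y => q.eval y) q.continuous.measurable q.continuousOn), ← integral_const_mul,
      ← Real.norm_eq_abs]
    refine norm_integral_le_of_norm_le (hv.const_mul η) ?_
    filter_upwards [h0] with u hu
    rw [← sub_mul, norm_mul, Real.norm_eq_abs, Real.norm_of_nonneg hu.2, abs_sub_comm]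
    exact mul_le_mul_of_nonneg_right (hq _ (hmem u hu.1)).le hu.2
  choose! q hq using fun ε (hε : 0 < ε) => exists_polynomial_near_of_continuousOn 0 1 G hG ε hε
  -- The zeroth power controls the total weights eventually, so the polynomial approximation error
  -- is uniform along `l`.
  have h0 := hlim 0
  simp only [pow_zero, one_mul] at h0
  have hsmall : ∀ x : ℝ, Tendsto (fun ε : ℝ => ε * x) (𝓝[>] 0) (𝓝 0) := fun x => by
    have : Tendsto (fun ε : ℝ => ε * x) (𝓝 0) (𝓝 (0 * x)) :=
      (continuous_id.mul continuous_const).tendsto 0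
    rw [zero_mul] at this
    exact this.mono_left nhdsWithin_le_nhds
  refine tendsto_of_approximation
    (Fε := fun ε i => ∫ u, (q ε).eval (Real.exp (-u)) * w u ∂M i)
    (J := fun ε => ∫ u, (q ε).eval (Real.exp (-u)) * w₀ u ∂M₀)
    (δ := fun ε => ε * (∫ u, w₀ u ∂M₀ + 1)) ?_ ?_ (hsmall _) ?_
  · intro ε _
    simp_rw [poly _ _ (hM _) (hw _), poly _ _ hM₀ hw₀]
    exact tendsto_finsetSum _ fun k _ => (hlim k).const_mul _
  · intro ε hε
    filter_upwards [h0.eventually (gt_mem_nhds (lt_add_one _))] with i hi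
    exact (diff _ _ (hM i) (hw i) (q ε) ε (hq ε hε)).trans
      (mul_le_mul_of_nonneg_left hi.le hε.le)
  · rw [tendsto_iff_norm_sub_tendsto_zero]
    refine squeeze_zero' (Eventually.of_forall fun _ => norm_nonneg _) ?_
      (hsmall (∫ u, w₀ u ∂M₀))
    filter_upwards [self_mem_nhdsWithin] with ε hε
    rw [Real.norm_eq_abs, abs_sub_comm]
    exact diff _ _ hM₀ hw₀ (q ε) ε (hq ε hε)

/-! ### The test function `expRemainder` -/

/-- The function `1 - e^{-y} - y e^{-y}`. -/
noncomputable def expRemainder (y : ℝ) : ℝ := 1 - (1 + y) * Real.exp (-y)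

@[fun_prop]
theorem continuous_expRemainder : Continuous expRemainder := by
  unfold expRemainder; fun_prop

theorem expRemainder_nonneg (y : ℝ) : 0 ≤ expRemainder y := by
  have h := mul_le_mul_of_nonneg_right (Real.add_one_le_exp y) (Real.exp_pos (-y)).le
  rw [← Real.exp_add, add_neg_cancel, Real.exp_zero] at h
  unfold expRemainder; linarith

theorem expRemainder_le_one {y : ℝ} (hy : 0 ≤ y) : expRemainder y ≤ 1 := by
  unfold expRemainder
  have : 0 ≤ (1 + y) * Real.exp (-y) := by positivity
  linarith

theorem expRemainder_le_sq {y : ℝ} (hy : 0 ≤ y) : expRemainder y ≤ y ^ 2 := by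
  unfold expRemainder
  nlinarith [mul_le_mul_of_nonneg_left (Real.add_one_le_exp (-y)) (by linarith : 0 ≤ 1 + y)]

/-- The c-derivative of `expRemainder (c * u)` is c u² e^{-cu}. Bounding the factors c and e^{-cu}
separately by their endpoint values gives the form needed by `tendsto_of_increment_bounds` with w =
id. -/
theorem expRemainder_increment {c c' u : ℝ} (hc : 0 < c) (hcc : c < c') (hu : 0 ≤ u) :
    c * (c' - c) * (u ^ 2 * Real.exp (-(c' * u))) ≤ expRemainder (c' * u) - expRemainder (c * u) ∧
      expRemainder (c' * u) - expRemainder (c * u) ≤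
        c' * (c' - c) * (u ^ 2 * Real.exp (-(c * u))) := by
  obtain ⟨δ, rfl⟩ : ∃ δ, c' = c + δ := ⟨c' - c, by ring⟩
  have hδ : 0 ≤ δ := by linarith
  unfold expRemainder
  have h1 := Real.add_one_le_exp (-(δ * u))
  have h2 := Real.add_one_le_exp (δ * u)
  constructor
  · have e1 : Real.exp (-(c * u)) = Real.exp (-((c + δ) * u)) * Real.exp (δ * u) := by
      rw [← Real.exp_add]; ring_nf
    rw [e1]
    have := mul_le_mul_of_nonneg_left h2
      (by positivity : 0 ≤ (1 + c * u) * Real.exp (-((c + δ) * u)))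
    linarith
  · have e1 : Real.exp (-((c + δ) * u)) = Real.exp (-(c * u)) * Real.exp (-(δ * u)) := by
      rw [← Real.exp_add]; ring_nf
    rw [e1]
    have := mul_le_mul_of_nonneg_left h1
      (by positivity : 0 ≤ (1 + (c + δ) * u) * Real.exp (-(c * u)))
    linarith

/-- The bound e^u ≥ 1 + u + u²/2 gives `expRemainder u` ≥ (u²/2)/(1 + u + u²/2), and the prefactor
is the reciprocal of the right side. -/
theorem one_le_mul_expRemainder {u : ℝ} (hu : 0 < u) :
    1 ≤ (2 * u⁻¹ ^ 2 + 2 * u⁻¹ + 1) * expRemainder u := by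
  have h1 := Real.quadratic_le_exp_of_nonneg hu.le
  have h2 : 0 < 1 + u + u ^ 2 / 2 := by positivity
  have h3 : Real.exp (-u) ≤ 1 / (1 + u + u ^ 2 / 2) := by
    rw [Real.exp_neg, ← one_div]; exact one_div_le_one_div_of_le h2 h1
  have h4 : (u ^ 2 / 2) / (1 + u + u ^ 2 / 2) ≤ expRemainder u := by
    have := mul_le_mul_of_nonneg_left h3 (by linarith : 0 ≤ 1 + u)
    unfold expRemainder
    refine le_trans (le_of_eq ?_) (sub_le_sub_left this 1)
    field_simp; ring
  refine le_trans (le_of_eq ?_) (mul_le_mul_of_nonneg_left h4 (by positivity))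
  field_simp

theorem rpow_mul_exp_neg_le {a v : ℝ} (ha : 0 ≤ a) (hv : 0 ≤ v) :
    v ^ a * Real.exp (-v / 4) ≤ (4 * a) ^ a := by
  rcases ha.eq_or_lt with rfl | ha
  · simpa using by linarith
  have h1 : v ≤ 4 * a * Real.exp (v / (4 * a)) := by
    have := Real.add_one_le_exp (v / (4 * a))
    calc v = 4 * a * (v / (4 * a)) := by field_simp
      _ ≤ _ := by gcongr; linarith
  have h2 := Real.rpow_le_rpow hv h1 ha.le
  rw [Real.mul_rpow (by positivity) (Real.exp_pos _).le, ← Real.exp_mul] at h2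
  calc _ ≤ (4 * a) ^ a * Real.exp (v / (4 * a) * a) * Real.exp (-v / 4) := by gcongr
    _ = (4 * a) ^ a := by
      rw [mul_assoc, ← Real.exp_add]
      have : v / (4 * a) * a + -v / 4 = 0 := by field_simp; ring
      rw [this]; simp

/-! ### The heat kernel at distance one: bounds, continuity, Mellin integral -/

/-- The heat kernel at distance one from the origin, as a function of time. -/
noncomputable def scaledKernel (d : ℕ) (u : ℝ) : ℝ :=
  (4 * Real.pi) ^ (-(d : ℝ) / 2) * (u⁻¹ ^ ((d : ℝ) / 2) * Real.exp (-u⁻¹ / 4))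

theorem scaledKernel_nonneg (d : ℕ) {u : ℝ} (hu : 0 ≤ u) : 0 ≤ scaledKernel d u := by
  unfold scaledKernel; positivity

@[fun_prop]
theorem measurable_scaledKernel (d : ℕ) : Measurable (scaledKernel d) := by
  unfold scaledKernel; fun_prop

theorem scaledKernel_zero {d : ℕ} (hd : 1 ≤ d) : scaledKernel d 0 = 0 := by
  have : (d : ℝ) ≠ 0 := by positivity
  simp [scaledKernel, Real.zero_rpow, this]

theorem exists_scaledKernel_le (d : ℕ) : ∃ C, ∀ u, 0 ≤ u → scaledKernel d u ≤ C :=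
  ⟨_, fun _ hu => mul_le_mul_of_nonneg_left
    (rpow_mul_exp_neg_le (by positivity) (inv_nonneg.2 hu)) (by positivity)⟩

/-- The kernel decays like u^{-d/2} at infinity, which for d ≥ 1 leaves room for a factor √u, and
near 0 it vanishes faster than any power while `expRemainder` is of order u². The spare √u pays for
removing the damping e^{-εu}. -/
theorem exists_scaledKernel_mul_sqrt_le {d : ℕ} (hd : 1 ≤ d) :
    ∃ C, 0 ≤ C ∧ ∀ u, 0 ≤ u → scaledKernel d u * √u ≤ C * expRemainder u := by
  set a : ℝ := ((d : ℝ) - 1) / 2 with ha_def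
  have ha : 0 ≤ a := by
    have : (1 : ℝ) ≤ d := by exact_mod_cast hd
    rw [ha_def]; linarith
  set Q : ℝ := (4 * Real.pi) ^ (-(d : ℝ) / 2) with hQ
  have hQ0 : 0 ≤ Q := by positivity
  refine ⟨Q * (2 * (4 * (a + 2)) ^ (a + 2) + 2 * (4 * (a + 1)) ^ (a + 1) + (4 * a) ^ a),
    by positivity, fun u hu => ?_⟩
  rcases hu.eq_or_lt with rfl | hu
  · simp [expRemainder]
  have hv : 0 < u⁻¹ := inv_pos.2 hu
  have e1 : scaledKernel d u * √u = Q * (u⁻¹ ^ a * Real.exp (-u⁻¹ / 4)) := by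
    have : √u = u⁻¹ ^ (-(1 / 2) : ℝ) := by
      rw [Real.sqrt_eq_rpow, Real.inv_rpow hu.le, Real.rpow_neg hu.le, inv_inv]
    rw [scaledKernel, this, ha_def, sub_div, sub_eq_add_neg, Real.rpow_add hv]
    ring
  rw [e1, mul_assoc]
  refine mul_le_mul_of_nonneg_left ?_ hQ0
  have h1 := rpow_mul_exp_neg_le ha hv.le
  have h2 := rpow_mul_exp_neg_le (by linarith : 0 ≤ a + 1) hv.le
  have h3 := rpow_mul_exp_neg_le (by linarith : 0 ≤ a + 2) hv.le
  rw [Real.rpow_add hv, Real.rpow_one] at h2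
  rw [Real.rpow_add hv, Real.rpow_two] at h3
  calc _ = u⁻¹ ^ a * Real.exp (-u⁻¹ / 4) * 1 := by ring
    _ ≤ u⁻¹ ^ a * Real.exp (-u⁻¹ / 4) * ((2 * u⁻¹ ^ 2 + 2 * u⁻¹ + 1) * expRemainder u) :=
      mul_le_mul_of_nonneg_left (one_le_mul_expRemainder hu) (by positivity)
    _ = (2 * (u⁻¹ ^ a * u⁻¹ ^ 2 * Real.exp (-u⁻¹ / 4)) +
          2 * (u⁻¹ ^ a * u⁻¹ * Real.exp (-u⁻¹ / 4)) +
          u⁻¹ ^ a * Real.exp (-u⁻¹ / 4)) * expRemainder u := by ring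
    _ ≤ _ := by
      refine mul_le_mul_of_nonneg_right ?_ (expRemainder_nonneg u)
      linarith

theorem continuousOn_rpow_inv_neg_log_mul_exp {s : ℝ} (hs : 0 < s) :
    ContinuousOn (fun y : ℝ => (-Real.log y)⁻¹ ^ s * Real.exp (-(-Real.log y)⁻¹ / 4))
      (Icc 0 1) := by
  set k : ℝ → ℝ := fun v => v ^ s * Real.exp (-v / 4) with hk
  have hkc : Continuous k := by
    have := Real.continuous_rpow_const hs.le
    fun_prop
  -- Since log 0 = log 1 = 0 and 0⁻¹ = 0, the function takes the value k 0 = 0 at both endpoints.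
  -- This agrees with the limits there: v = (-log y)⁻¹ tends to 0 as y → 0 and to ∞ as y → 1.
  have hk0 : k 0 = 0 := by simp [hk, Real.zero_rpow hs.ne']
  have hk1 : Tendsto k atTop (𝓝 0) := by
    refine (tendsto_rpow_mul_exp_neg_mul_atTop_nhds_zero s (1 / 4) (by norm_num)).congr fun v => ?_
    simp only [hk]; congr 2; ring
  change ContinuousOn (fun y => k (-Real.log y)⁻¹) (Icc 0 1)
  intro y hy
  rcases hy.1.eq_or_lt with rfl | hy0
  · have h : ContinuousWithinAt (fun y => k (-Real.log y)⁻¹) (Ioi 0) 0 := by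
      have h1 : Tendsto (fun y => k (-Real.log y)⁻¹) (𝓝[>] 0) (𝓝 (k 0)) :=
        (hkc.tendsto 0).comp (tendsto_inv_atTop_zero.comp
          (tendsto_neg_atBot_atTop.comp Real.tendsto_log_nhdsGT_zero))
      simpa [ContinuousWithinAt] using h1
    refine (continuousWithinAt_insert_self.2 h).mono fun z hz => ?_
    rcases hz.1.eq_or_lt with rfl | h2
    · exact Or.inl rfl
    · exact Or.inr h2
  · rcases hy.2.eq_or_lt with rfl | hy1
    · have h : ContinuousWithinAt (fun y => k (-Real.log y)⁻¹) (Ioo 0 1) 1 := by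
        have h0 : Tendsto (fun y => -Real.log y) (𝓝[Ioo 0 1] 1) (𝓝[>] 0) := by
          refine tendsto_nhdsWithin_iff.2 ⟨?_, ?_⟩
          · have : Tendsto (fun y => -Real.log y) (𝓝 1) (𝓝 (-Real.log 1)) :=
              (Real.continuousAt_log one_ne_zero).neg
            rw [Real.log_one, neg_zero] at this
            exact this.mono_left nhdsWithin_le_nhds
          · filter_upwards [self_mem_nhdsWithin] with z hz
            exact neg_pos.2 (Real.log_neg hz.1 hz.2)
        have h1 : Tendsto (fun y => k (-Real.log y)⁻¹) (𝓝[Ioo 0 1] 1) (𝓝 0) :=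
          hk1.comp (tendsto_inv_nhdsGT_zero.comp h0)
        simpa [ContinuousWithinAt, hk0] using h1
      refine ((continuousWithinAt_insert_self.2 h).mono_of_mem_nhdsWithin ?_)
      filter_upwards [self_mem_nhdsWithin, mem_nhdsWithin_of_mem_nhds (lt_mem_nhds hy0)]
        with z hz hz0
      rcases hz.2.eq_or_lt with rfl | h2
      · exact Or.inl rfl
      · exact Or.inr ⟨hz0, h2⟩
    · have h1 : -Real.log y ≠ 0 := (neg_pos.2 (Real.log_neg hy0 hy1)).ne'
      exact (hkc.continuousAt.comp
        (((Real.continuousAt_log hy0.ne').neg).inv₀ h1)).continuousWithinAt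

/-- The substitution v = 1/u turns this into a Gamma integral with rate 1/4. -/
theorem integral_scaledKernel_mul_rpow {d : ℕ} (hd : 1 ≤ d) {γ : ℝ} (hγ : 0 ≤ γ) :
    IntegrableOn (fun u => scaledKernel d u * u ^ (-1 - γ)) (Ioi 0) ∧
      ∫ u in Ioi 0, scaledKernel d u * u ^ (-1 - γ) =
        4 ^ γ * Real.pi ^ (-(d : ℝ) / 2) * Real.Gamma ((d : ℝ) / 2 + γ) := by
  have hd' : (0 : ℝ) < d := by exact_mod_cast hd
  have hs : 0 < (d : ℝ) / 2 + γ := by positivity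
  set g : ℝ → ℝ := fun v => v ^ ((d : ℝ) / 2 + γ - 1) * Real.exp (-(1 / 4 * v)) with hg
  have hgi : IntegrableOn g (Ioi 0) := by
    refine (integrableOn_rpow_mul_exp_neg_mul_rpow (p := 1) (b := 1 / 4)
      (by linarith : -1 < (d : ℝ) / 2 + γ - 1) one_pos (by norm_num)).congr_fun
      (fun x _ => ?_) measurableSet_Ioi
    simp [hg]
  have hcongr : EqOn (fun u => (4 * Real.pi) ^ (-(d : ℝ) / 2) *
      ((|(-1 : ℝ)| * u ^ ((-1 : ℝ) - 1)) • g (u ^ (-1 : ℝ))))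
      (fun u => scaledKernel d u * u ^ (-1 - γ)) (Ioi 0) := by
    intro u hu
    have hu : 0 < u := hu
    have h1 : u⁻¹ ^ ((d : ℝ) / 2 + γ - 1) = u⁻¹ ^ ((d : ℝ) / 2) * u ^ (-γ) * u := by
      rw [sub_eq_add_neg, Real.rpow_add (inv_pos.2 hu), Real.rpow_add (inv_pos.2 hu),
        Real.rpow_neg (inv_pos.2 hu).le 1, Real.rpow_one, inv_inv, Real.rpow_neg hu.le,
        Real.inv_rpow hu.le γ]
    have h2 : u ^ ((-1 : ℝ) - 1) = u⁻¹ * u⁻¹ := by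
      rw [sub_eq_add_neg, Real.rpow_add hu, Real.rpow_neg_one]
    have h3 : u ^ (-1 - γ) = u⁻¹ * u ^ (-γ) := by
      rw [sub_eq_add_neg, Real.rpow_add hu, Real.rpow_neg_one]
    have h4 : -(1 / 4 * u⁻¹) = -u⁻¹ / 4 := by ring
    simp only [hg, scaledKernel, Real.rpow_neg_one, h1, h2, h3, h4, abs_neg, abs_one, one_mul,
      smul_eq_mul]
    field_simp
  have hgi' : IntegrableOn (fun u => (4 * Real.pi) ^ (-(d : ℝ) / 2) *
      ((|(-1 : ℝ)| * u ^ ((-1 : ℝ) - 1)) • g (u ^ (-1 : ℝ)))) (Ioi 0) :=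
    ((integrableOn_Ioi_comp_rpow_iff g (by norm_num : (-1 : ℝ) ≠ 0)).2 hgi).const_mul _
  refine ⟨hgi'.congr_fun hcongr measurableSet_Ioi, ?_⟩
  rw [← setIntegral_congr_fun measurableSet_Ioi hcongr, integral_const_mul,
    integral_comp_rpow_Ioi g (by norm_num : (-1 : ℝ) ≠ 0),
    Real.integral_rpow_mul_exp_neg_mul_Ioi hs (by norm_num)]
  have h4 : (1 / (1 / 4) : ℝ) = 4 := by norm_num
  rw [h4, Real.mul_rpow (by norm_num) Real.pi_pos.le, Real.rpow_add (by norm_num), neg_div,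
    Real.rpow_neg (by norm_num : (0 : ℝ) ≤ 4)]
  have : (4 : ℝ) ^ ((d : ℝ) / 2) ≠ 0 := by positivity
  field_simp

theorem integrable_of_forall_nonneg {m : Measure ℝ} [IsFiniteMeasure m]
    (h0 : ∀ᵐ u ∂m, 0 ≤ u) {f : ℝ → ℝ} (hf : Measurable f) {C : ℝ}
    (hC : ∀ u, 0 ≤ u → |f u| ≤ C) : Integrable f m :=
  Integrable.of_bound hf.aestronglyMeasurable C (h0.mono hC)

theorem sq_mul_exp_neg_le {a u : ℝ} (ha : 0 < a) (hu : 0 ≤ u) :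
    u ^ 2 * Real.exp (-(a * u)) ≤ (a / 2)⁻¹ ^ 2 := by
  have h1 : a / 2 * u ≤ Real.exp (a / 2 * u) := by linarith [Real.add_one_le_exp (a / 2 * u)]
  have h2 := pow_le_pow_left₀ (by positivity) h1 2
  have h3 : Real.exp (a * u) = Real.exp (a / 2 * u) ^ 2 := by
    rw [← Real.exp_nat_mul]; congr 1; push_cast; ring
  rw [Real.exp_neg, h3, ← div_eq_mul_inv, div_le_iff₀ (by positivity)]
  calc u ^ 2 = (a / 2)⁻¹ ^ 2 * (a / 2 * u) ^ 2 := by field_simp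
    _ ≤ _ := by gcongr

theorem integral_rpow_mul_exp_neg_density {γ b : ℝ} (hγ2 : γ < 2) (hb : 0 < b) :
    IntegrableOn (fun u : ℝ => u ^ (1 - γ) * Real.exp (-(b * u))) (Ioi 0) ∧
      ∫ u in Ioi 0, u ^ (1 - γ) * Real.exp (-(b * u)) = b ^ (γ - 2) * Real.Gamma (2 - γ) := by
  constructor
  · refine (integrableOn_rpow_mul_exp_neg_mul_rpow (p := 1) (b := b)
      (by linarith : -1 < 1 - γ) one_pos hb).congr_fun (fun x _ => ?_) measurableSet_Ioi
    simp
  · have := Real.integral_rpow_mul_exp_neg_mul_Ioi (by linarith : 0 < 2 - γ) hb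
    rw [show 2 - γ - 1 = 1 - γ by ring] at this
    rw [this, one_div, Real.inv_rpow hb.le, ← Real.rpow_neg hb.le, neg_sub]

/-! ### The Tauberian argument for a family of finite measures -/

section Core

variable {ι : Type*} {l : Filter ι} {M : ι → Measure ℝ} {κ γ : ℝ}

theorem tendsto_integral_sq_mul_exp_neg [∀ i, IsFiniteMeasure (M i)]
    (h0 : ∀ i, ∀ᵐ u ∂M i, 0 ≤ u)
    (hlim : ∀ c, 0 < c → Tendsto (fun i => ∫ u, expRemainder (c * u) ∂M i) l (𝓝 (κ * c ^ γ)))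
    {a : ℝ} (ha : 0 < a) :
    Tendsto (fun i => ∫ u, u ^ 2 * Real.exp (-(a * u)) ∂M i) l (𝓝 (κ * γ * a ^ (γ - 2))) := by
  have hint1 : ∀ i c, 0 < c → Integrable (fun u => expRemainder (c * u)) (M i) := fun i c hc =>
    integrable_of_forall_nonneg (h0 i) (C := 1) (by fun_prop) fun u hu => by
      rw [abs_of_nonneg (expRemainder_nonneg _)]
      exact expRemainder_le_one (by positivity)
  have hint2 : ∀ i c, 0 < c → Integrable (fun u => u ^ 2 * Real.exp (-(c * u))) (M i) :=
    fun i c hc => integrable_of_forall_nonneg (h0 i) (by fun_prop) fun u hu => by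
      rw [abs_of_nonneg (by positivity)]
      exact sq_mul_exp_neg_le hc hu
  have := tendsto_of_increment_bounds (l := l) (w := id) (A₀ := fun c => κ * c ^ γ)
    (A := fun i c => ∫ u, expRemainder (c * u) ∂M i)
    (Ψ := fun i a => ∫ u, u ^ 2 * Real.exp (-(a * u)) ∂M i) ha continuousAt_id ha
    ((Real.hasDerivAt_rpow_const (Or.inl ha.ne')).const_mul κ) hlim ?_
  · convert this using 2
    rw [show γ - 2 = γ - 1 - 1 by ring, Real.rpow_sub_one ha.ne', id]
    ring
  · intro i c c' hc hcc
    have hc' := hc.trans hcc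
    rw [← integral_sub (hint1 i c' hc') (hint1 i c hc), ← integral_const_mul,
      ← integral_const_mul]
    refine ⟨integral_mono_ae ((hint2 i c' hc').const_mul _)
      ((hint1 i c' hc').sub (hint1 i c hc)) ?_, integral_mono_ae
      ((hint1 i c' hc').sub (hint1 i c hc)) ((hint2 i c hc).const_mul _) ?_⟩
    · filter_upwards [h0 i] with u hu using (expRemainder_increment hc hcc hu).1
    · filter_upwards [h0 i] with u hu using (expRemainder_increment hc hcc hu).2

/-- With weight u² e^{-εu}, the powers of e^{-u} have integrals of the form ∫ u² e^{-au} with a = ε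
+ k > 0, whose limits are known. The damping is needed because the limit κγ a^{γ-2} is available
only for a > 0. -/
theorem tendsto_integral_scaledKernel_mul_exp_neg {d : ℕ} (hd : 1 ≤ d)
    [∀ i, IsFiniteMeasure (M i)] (h0 : ∀ i, ∀ᵐ u ∂M i, 0 ≤ u)
    (hκ : 0 ≤ κ) (hγ : 0 ≤ γ) (hγ2 : γ < 2)
    (hlim : ∀ c, 0 < c → Tendsto (fun i => ∫ u, expRemainder (c * u) ∂M i) l (𝓝 (κ * c ^ γ)))
    {ε : ℝ} (hε : 0 < ε) :
    Tendsto (fun i => ∫ u, scaledKernel d u * Real.exp (-(ε * u)) ∂M i) l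
      (𝓝 (∫ u in Ioi 0, κ * γ / Real.Gamma (2 - γ) *
        (scaledKernel d u * u ^ (-1 - γ)) * Real.exp (-(ε * u)))) := by
  set Q : ℝ := κ * γ / Real.Gamma (2 - γ) with hQ
  have hΓ : 0 < Real.Gamma (2 - γ) := Real.Gamma_pos_of_pos (by linarith)
  have hQ0 : 0 ≤ Q := by positivity
  have hd' : (0 : ℝ) < d := by exact_mod_cast hd
  -- G(e^{-u}) is the kernel divided by u², which raises the exponent of u⁻¹ to d/2 + 2. The factor
  -- e^{-1/(4u)} keeps G continuous at y = 1.
  set G : ℝ → ℝ := fun y => (4 * Real.pi) ^ (-(d : ℝ) / 2) *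
    ((-Real.log y)⁻¹ ^ ((d : ℝ) / 2 + 2) * Real.exp (-(-Real.log y)⁻¹ / 4)) with hGdef
  have hG : ContinuousOn G (Icc 0 1) :=
    continuousOn_const.mul (continuousOn_rpow_inv_neg_log_mul_exp (by positivity))
  have hGm : Measurable G := by fun_prop
  have hGu : ∀ u, 0 ≤ u → G (Real.exp (-u)) * u ^ 2 = scaledKernel d u := by
    intro u hu
    rcases hu.eq_or_lt with rfl | hu
    · simp [scaledKernel_zero hd]
    · simp only [hGdef, Real.log_exp, neg_neg, scaledKernel]
      rw [Real.rpow_add (inv_pos.2 hu), Real.rpow_two]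
      field_simp
  have hpow : ∀ (k : ℕ) (u : ℝ), Real.exp (-u) ^ k * Real.exp (-(ε * u)) =
      Real.exp (-((ε + k) * u)) := fun k u => by
    rw [← Real.exp_nat_mul, ← Real.exp_add]; congr 1; ring
  have h := tendsto_integral_comp_exp_neg (l := l) (M := M) (M₀ := volume.restrict (Ioi 0))
    (w := fun u => u ^ 2 * Real.exp (-(ε * u)))
    (w₀ := fun u => Q * (u ^ (1 - γ) * Real.exp (-(ε * u)))) ?_ ?_ ?_ ?_ ?_ hG hGm
  · refine (h.congr fun i => ?_).trans (le_of_eq (congrArg 𝓝 ?_))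
    · refine integral_congr_ae ?_
      filter_upwards [h0 i] with u hu
      rw [← hGu u hu]; ring
    · refine setIntegral_congr_fun measurableSet_Ioi fun u hu => ?_
      have hu : 0 < u := hu
      have : u ^ (1 - γ) = u ^ 2 * u ^ (-1 - γ) := by
        rw [← Real.rpow_two, ← Real.rpow_add hu]; congr 1; ring
      simp only [this, ← hGu u hu.le]; ring
  · intro i
    filter_upwards [h0 i] with u hu using ⟨hu, by positivity⟩
  · filter_upwards [ae_restrict_mem measurableSet_Ioi] with u hu
    have hu : 0 < u := hu
    exact ⟨hu.le, by positivity⟩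
  · intro i
    refine integrable_of_forall_nonneg (h0 i) (C := (ε / 2)⁻¹ ^ 2) (by fun_prop) fun u hu => ?_
    rw [abs_of_nonneg (by positivity)]
    exact sq_mul_exp_neg_le hε hu
  · exact (integral_rpow_mul_exp_neg_density hγ2 hε).1.const_mul Q
  · intro k
    have hk : 0 < ε + k := by positivity
    refine ((tendsto_integral_sq_mul_exp_neg h0 hlim hk).congr fun i => ?_).trans
      (le_of_eq (congrArg 𝓝 ?_))
    · refine integral_congr_ae (Eventually.of_forall fun u => ?_)
      simp only [← hpow]; ring
    · calc κ * γ * (ε + k) ^ (γ - 2) = Q * ((ε + k) ^ (γ - 2) * Real.Gamma (2 - γ)) := by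
            rw [hQ]; field_simp
        _ = ∫ u in Ioi 0, Q * (u ^ (1 - γ) * Real.exp (-((ε + k) * u))) := by
            rw [integral_const_mul, (integral_rpow_mul_exp_neg_density hγ2 hk).2]
        _ = _ := by
            congr 1; ext u; rw [← hpow]; ring

/-- If `∫ (1 - e^{-cu} - cu e^{-cu}) M(du)` converges to `κ c ^ γ` for all `c > 0`, then the
integrals of the scaled heat kernel converge. -/
theorem tendsto_integral_scaledKernel {d : ℕ} (hd : 1 ≤ d)
    [∀ i, IsFiniteMeasure (M i)] (h0 : ∀ i, ∀ᵐ u ∂M i, 0 ≤ u)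
    (hκ : 0 ≤ κ) (hγ : 0 ≤ γ) (hγ2 : γ < 2)
    (hlim : ∀ c, 0 < c → Tendsto (fun i => ∫ u, expRemainder (c * u) ∂M i) l (𝓝 (κ * c ^ γ))) :
    Tendsto (fun i => ∫ u, scaledKernel d u ∂M i) l
      (𝓝 (κ * γ / Real.Gamma (2 - γ) *
        (4 ^ γ * Real.pi ^ (-(d : ℝ) / 2) * Real.Gamma ((d : ℝ) / 2 + γ)))) := by
  obtain ⟨hB, hBint⟩ := integral_scaledKernel_mul_rpow hd hγ
  obtain ⟨C, hC0, hC⟩ := exists_scaledKernel_mul_sqrt_le hd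
  obtain ⟨K, hK⟩ := exists_scaledKernel_le d
  rw [← hBint, ← integral_const_mul]
  have hlim1 := hlim 1 one_pos
  simp only [one_mul, Real.one_rpow, mul_one] at hlim1
  -- The error comes from 1 - e^{-εu} ≤ √(εu) and the bound of the kernel times √u by C r(u), where
  -- ∫ r dM is eventually below κ + 1.
  refine tendsto_of_approximation
    (Fε := fun ε i => ∫ u, scaledKernel d u * Real.exp (-(ε * u)) ∂M i)
    (δ := fun ε => √ε * (C * (κ + 1)))
    (fun ε hε => tendsto_integral_scaledKernel_mul_exp_neg hd h0 hκ hγ hγ2 hlim hε) ?_ ?_ ?_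
  · intro ε hε
    filter_upwards [hlim1.eventually (gt_mem_nhds (lt_add_one κ))] with i hi
    have hi1 : Integrable (scaledKernel d) (M i) :=
      integrable_of_forall_nonneg (h0 i) (by fun_prop) fun u hu => by
        rw [abs_of_nonneg (scaledKernel_nonneg d hu)]; exact hK u hu
    have hi2 : Integrable (fun u => scaledKernel d u * Real.exp (-(ε * u))) (M i) :=
      integrable_of_forall_nonneg (C := K) (h0 i) (by fun_prop) fun u hu => by
        have h1 := scaledKernel_nonneg d hu
        rw [abs_of_nonneg (by positivity)]
        have h2 : Real.exp (-(ε * u)) ≤ 1 := Real.exp_le_one_iff.2 (by nlinarith)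
        exact (mul_le_of_le_one_right h1 h2).trans (hK u hu)
    have hi3 : Integrable expRemainder (M i) :=
      integrable_of_forall_nonneg (C := 1) (h0 i) (by fun_prop) fun u hu => by
        rw [abs_of_nonneg (expRemainder_nonneg _)]; exact expRemainder_le_one hu
    rw [← integral_sub hi1 hi2, ← Real.norm_eq_abs]
    calc _ ≤ ∫ u, √ε * C * expRemainder u ∂M i := by
          refine norm_integral_le_of_norm_le (hi3.const_mul _) ?_
          filter_upwards [h0 i] with u hu
          have h1 := scaledKernel_nonneg d hu
          have hx : 0 ≤ ε * u := by positivity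
          have h2 : Real.exp (-(ε * u)) ≤ 1 := Real.exp_le_one_iff.2 (by linarith)
          have h3 : 1 - Real.exp (-(ε * u)) ≤ √(ε * u) := by
            rcases le_total (ε * u) 1 with h | h
            · have h4 : ε * u ≤ √(ε * u) := Real.le_sqrt_of_sq_le (by nlinarith)
              linarith [Real.add_one_le_exp (-(ε * u))]
            · have h4 : 1 ≤ √(ε * u) := Real.one_le_sqrt.2 h
              linarith [Real.exp_pos (-(ε * u))]
          rw [Real.sqrt_mul hε.le] at h3
          rw [Real.norm_of_nonneg (by nlinarith)]
          calc _ = scaledKernel d u * (1 - Real.exp (-(ε * u))) := by ring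
            _ ≤ scaledKernel d u * (√ε * √u) := mul_le_mul_of_nonneg_left h3 h1
            _ = √ε * (scaledKernel d u * √u) := by ring
            _ ≤ √ε * (C * expRemainder u) := mul_le_mul_of_nonneg_left (hC u hu) (by positivity)
            _ = _ := by ring
      _ = √ε * (C * ∫ u, expRemainder u ∂M i) := by rw [integral_const_mul]; ring
      _ ≤ _ := by gcongr
  · have : Tendsto (fun ε => √ε * (C * (κ + 1))) (𝓝 0) (𝓝 (√0 * (C * (κ + 1)))) :=
      (Real.continuous_sqrt.mul continuous_const).tendsto 0
    rw [Real.sqrt_zero, zero_mul] at this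
    exact this.mono_left nhdsWithin_le_nhds
  · refine tendsto_integral_filter_of_dominated_convergence
      (fun u => ‖κ * γ / Real.Gamma (2 - γ) * (scaledKernel d u * u ^ (-1 - γ))‖) ?_ ?_
      (hB.const_mul _).norm ?_
    · exact Eventually.of_forall fun ε => by fun_prop
    · filter_upwards [self_mem_nhdsWithin] with ε hε
      filter_upwards [ae_restrict_mem measurableSet_Ioi] with u hu
      have h2 : Real.exp (-(ε * u)) ≤ 1 :=
        Real.exp_le_one_iff.2 (neg_nonpos.2 (mul_pos hε hu).le)
      rw [norm_mul, Real.norm_of_nonneg (Real.exp_pos _).le]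
      exact mul_le_of_le_one_right (norm_nonneg _) h2
    · refine Eventually.of_forall fun u => ?_
      have : Continuous fun ε : ℝ => κ * γ / Real.Gamma (2 - γ) *
        (scaledKernel d u * u ^ (-1 - γ)) * Real.exp (-(ε * u)) := by fun_prop
      simpa using (this.tendsto 0).mono_left nhdsWithin_le_nhds

/-- Differentiating the assumed limit in c gives ∫ u e^{-cu} dM → γ c^{γ-1}. Subtracting c times
this from c^γ leaves (1-γ) c^γ. -/
theorem tendsto_integral_expRemainder [∀ i, IsFiniteMeasure (M i)]
    (h0 : ∀ i, ∀ᵐ u ∂M i, 0 ≤ u)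
    (hlim : ∀ c, 0 < c → Tendsto (fun i => ∫ u, (1 - Real.exp (-(c * u))) ∂M i) l (𝓝 (c ^ γ)))
    {c : ℝ} (hc : 0 < c) :
    Tendsto (fun i => ∫ u, expRemainder (c * u) ∂M i) l (𝓝 ((1 - γ) * c ^ γ)) := by
  have hexp : ∀ c u : ℝ, 0 < c → 0 ≤ u → Real.exp (-(c * u)) ≤ 1 := fun c u hc hu =>
    Real.exp_le_one_iff.2 (neg_nonpos.2 (by positivity))
  have hint1 : ∀ i c, 0 < c → Integrable (fun u => 1 - Real.exp (-(c * u))) (M i) :=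
    fun i c hc => integrable_of_forall_nonneg (h0 i) (C := 1) (by fun_prop) fun u hu => by
      rw [abs_of_nonneg (sub_nonneg.2 (hexp c u hc hu))]
      linarith [Real.exp_pos (-(c * u))]
  have hint2 : ∀ i c, 0 < c → Integrable (fun u => u * Real.exp (-(c * u))) (M i) :=
    fun i c hc => integrable_of_forall_nonneg (h0 i) (C := c⁻¹) (by fun_prop) fun u hu => by
      rw [abs_of_nonneg (by positivity), Real.exp_neg, ← div_eq_mul_inv,
        div_le_iff₀ (Real.exp_pos _), inv_mul_eq_div, le_div_iff₀ hc]
      linarith [Real.add_one_le_exp (c * u)]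
  have h := tendsto_of_increment_bounds (l := l) (w := fun _ => 1) (A₀ := fun c => c ^ γ)
    (A := fun i c => ∫ u, (1 - Real.exp (-(c * u))) ∂M i)
    (Ψ := fun i a => ∫ u, u * Real.exp (-(a * u)) ∂M i) hc continuousAt_const one_pos
    (Real.hasDerivAt_rpow_const (Or.inl hc.ne')) hlim ?_
  · have h' := (hlim c hc).sub (h.const_mul c)
    refine (h'.congr fun i => ?_).trans (le_of_eq (congrArg 𝓝 ?_))
    · rw [← integral_const_mul, ← integral_sub (hint1 i c hc) ((hint2 i c hc).const_mul c)]
      congr 1; ext u; unfold expRemainder; ring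
    · rw [Real.rpow_sub_one hc.ne']; field_simp
  · intro i c c' hc hcc
    have hc' := hc.trans hcc
    rw [← integral_sub (hint1 i c' hc') (hint1 i c hc), ← integral_const_mul,
      ← integral_const_mul, one_mul]
    have hδ : 0 < c' - c := sub_pos.2 hcc
    refine ⟨integral_mono_ae ((hint2 i c' hc').const_mul _)
      ((hint1 i c' hc').sub (hint1 i c hc)) ?_, integral_mono_ae
      ((hint1 i c' hc').sub (hint1 i c hc)) ((hint2 i c hc).const_mul _) ?_⟩
    · filter_upwards [h0 i] with u hu
      have e1 : Real.exp (-(c * u)) = Real.exp (-(c' * u)) * Real.exp ((c' - c) * u) := by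
        rw [← Real.exp_add]; ring_nf
      have := mul_le_mul_of_nonneg_left (Real.add_one_le_exp ((c' - c) * u))
        (Real.exp_pos (-(c' * u))).le
      rw [e1]; linarith
    · filter_upwards [h0 i] with u hu
      have e1 : Real.exp (-(c' * u)) = Real.exp (-(c * u)) * Real.exp (-((c' - c) * u)) := by
        rw [← Real.exp_add]; ring_nf
      have := mul_le_mul_of_nonneg_left (Real.add_one_le_exp (-((c' - c) * u)))
        (Real.exp_pos (-(c * u))).le
      rw [e1]; linarith

end Core

/-! ### Identities and inequalities for the Laplace exponent -/

section Laplace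

variable {Ω : Type*} [MeasurableSpace Ω] {P : Measure Ω} [IsProbabilityMeasure P]
  {T : ℝ≥0 → Ω → ℝ≥0} {φ : ℝ → ℝ}

theorem mem_interior_integrableExpSet {S : Ω → ℝ≥0} (hS : Measurable S) {l : ℝ} (hl : 0 < l) :
    -l ∈ interior (integrableExpSet (fun ω => (S ω : ℝ)) P) := by
  refine interior_mono (s := Iio 0) (fun a ha => ?_) (by rw [interior_Iio]; simpa using hl)
  refine Integrable.of_bound (by fun_prop) 1 (Eventually.of_forall fun ω => ?_)
  rw [Real.norm_of_nonneg (Real.exp_pos _).le]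
  exact Real.exp_le_one_iff.2 (mul_nonpos_of_nonpos_of_nonneg (le_of_lt ha) (S ω).2)

theorem IsLaplaceExponent.hasDerivAt_exp (hT : ∀ t, Measurable (T t))
    (hφ : IsLaplaceExponent φ T P) (t : ℝ≥0) {l : ℝ} (hl : 0 < l) :
    HasDerivAt (fun a => Real.exp (-(t : ℝ) * φ a))
      (-∫ ω, (T t ω : ℝ) * Real.exp (-l * (T t ω : ℝ)) ∂P) l := by
  have h1 := (hasDerivAt_mgf (mem_interior_integrableExpSet (P := P) (hT t) hl)).comp l
    (hasDerivAt_neg l)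
  rw [mul_neg_one] at h1
  refine h1.congr_of_eventuallyEq ?_
  filter_upwards [lt_mem_nhds hl] with a ha
  exact ((hφ a ha).2 t).symm

theorem IsLaplaceExponent.differentiableAt (hT : ∀ t, Measurable (T t))
    (hφ : IsLaplaceExponent φ T P) {l : ℝ} (hl : 0 < l) : DifferentiableAt ℝ φ l := by
  have h := ((hφ.hasDerivAt_exp hT 1 hl).log (Real.exp_pos _).ne').neg.differentiableAt
  refine h.congr_of_eventuallyEq (Eventually.of_forall fun a => ?_)
  simp

theorem IsLaplaceExponent.integral_mul_exp_neg (hT : ∀ t, Measurable (T t))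
    (hφ : IsLaplaceExponent φ T P) (t : ℝ≥0) {l : ℝ} (hl : 0 < l) :
    ∫ ω, (T t ω : ℝ) * Real.exp (-l * (T t ω : ℝ)) ∂P =
      t * deriv φ l * Real.exp (-(t : ℝ) * φ l) := by
  have h1 := hφ.hasDerivAt_exp hT t hl
  have h2 := ((hφ.differentiableAt hT hl).hasDerivAt.const_mul (-(t : ℝ))).exp
  linarith [h1.unique h2]

theorem IsLaplaceExponent.lowerFunction_le (hT : ∀ t, Measurable (T t))
    (hφ : IsLaplaceExponent φ T P) {l : ℝ} (hl : 0 < l) : lowerFunction φ l ≤ φ l := by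
  have h1 := hφ.integral_mul_exp_neg hT 1 hl
  have h2 : 0 ≤ ∫ ω, (T 1 ω : ℝ) * Real.exp (-l * (T 1 ω : ℝ)) ∂P :=
    integral_nonneg fun ω => by positivity
  rw [h1, NNReal.coe_one, one_mul] at h2
  have h3 := nonneg_of_mul_nonneg_left h2 (Real.exp_pos _)
  have := mul_nonneg hl.le h3
  unfold lowerFunction; linarith

theorem integrable_exp_neg_mul {S : Ω → ℝ≥0} (hS : Measurable S) {l : ℝ} (hl : 0 < l) :
    Integrable (fun ω => Real.exp (-l * (S ω : ℝ))) P :=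
  interior_subset (s := integrableExpSet (fun ω => (S ω : ℝ)) P)
    (mem_interior_integrableExpSet hS hl)

theorem IsLaplaceExponent.integral_expRemainder (hT : ∀ t, Measurable (T t))
    (hφ : IsLaplaceExponent φ T P) (t : ℝ≥0) {l : ℝ} (hl : 0 < l) :
    ∫ ω, expRemainder (l * (T t ω : ℝ)) ∂P =
      expRemainder (t * φ l) + t * lowerFunction φ l * Real.exp (-(t * φ l)) := by
  have hi := integrable_exp_neg_mul (P := P) (hT t) hl
  have hi2 : Integrable (fun ω => (T t ω : ℝ) * Real.exp (-l * (T t ω : ℝ))) P := by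
    refine Integrable.of_bound (by fun_prop) l⁻¹ (Eventually.of_forall fun ω => ?_)
    rw [Real.norm_of_nonneg (by positivity), neg_mul, Real.exp_neg, ← div_eq_mul_inv,
      div_le_iff₀ (Real.exp_pos _), inv_mul_eq_div, le_div_iff₀ hl]
    linarith [Real.add_one_le_exp (l * (T t ω : ℝ))]
  have h1 : ∀ ω, expRemainder (l * (T t ω : ℝ)) = 1 - Real.exp (-l * (T t ω : ℝ)) -
      l * ((T t ω : ℝ) * Real.exp (-l * (T t ω : ℝ))) := fun ω => by
    unfold expRemainder; rw [neg_mul]; ring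
  simp_rw [h1]
  have hi3 : Integrable (fun ω => 1 - Real.exp (-l * (T t ω : ℝ))) P :=
    (integrable_const _).sub hi
  rw [integral_sub hi3 (hi2.const_mul l), integral_sub (integrable_const _) hi, integral_const_mul, (hφ l hl).2 t,
    hφ.integral_mul_exp_neg hT t hl]
  simp only [integral_const, probReal_univ, one_smul, expRemainder, lowerFunction, neg_mul]
  ring

/-- For c ≥ 1 this is Jensen's inequality for y ↦ y^c applied to e^{-lT_1}. For c ≤ 1 it is
monotonicity of φ. It transfers control of tφ(λ) to tφ(cλ) when only H is assumed to vary regularly.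
-/
theorem IsLaplaceExponent.apply_mul_le (hT : ∀ t, Measurable (T t))
    (hφ : IsLaplaceExponent φ T P) {c l : ℝ} (hc : 0 < c) (hl : 0 < l) :
    φ (c * l) ≤ max 1 c * φ l := by
  have hcl : 0 < c * l := by positivity
  have hi1 := integrable_exp_neg_mul (P := P) (hT 1) hl
  have hi2 := integrable_exp_neg_mul (P := P) (hT 1) hcl
  have h1 := (hφ l hl).2 1
  have h2 := (hφ _ hcl).2 1
  have hφl := (hφ l hl).1
  rcases le_total 1 c with h | h
  · rw [max_eq_right h]
    have h3 := (convexOn_rpow h).map_integral_le (μ := P)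
      (f := fun ω => Real.exp (-l * (T 1 ω : ℝ)))
      (Real.continuous_rpow_const hc.le).continuousOn isClosed_Ici
      (Eventually.of_forall fun ω => (Real.exp_pos _).le) hi1 (hi2.congr ?_)
    · have h4 : ∀ ω, Real.exp (-l * (T 1 ω : ℝ)) ^ c = Real.exp (-(c * l) * (T 1 ω : ℝ)) :=
        fun ω => by rw [← Real.exp_mul]; congr 1; ring
      simp_rw [h4] at h3
      rw [h1, h2, ← Real.exp_mul, Real.exp_le_exp] at h3
      simp only [NNReal.coe_one] at h3
      linarith
    · refine Eventually.of_forall fun ω => ?_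
      simp only [Function.comp]
      rw [← Real.exp_mul]; congr 1; ring
  · rw [max_eq_left h, one_mul]
    have h3 : ∫ ω, Real.exp (-l * (T 1 ω : ℝ)) ∂P ≤
        ∫ ω, Real.exp (-(c * l) * (T 1 ω : ℝ)) ∂P := by
      refine integral_mono hi1 hi2 fun ω => Real.exp_le_exp.2 ?_
      refine mul_le_mul_of_nonneg_right (neg_le_neg ?_) (T 1 ω).2
      nlinarith
    rw [h1, h2, Real.exp_le_exp] at h3
    simp only [NNReal.coe_one] at h3
    linarith

end Laplace

/-! ### Scaling of the density and the two asymptotic statements -/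

theorem heatKernel_eq_scaledKernel {d : ℕ} (hd : 1 ≤ d) {x : EuclideanSpace ℝ (Fin d)}
    (hx : 0 < ‖x‖) {s : ℝ} (hs : 0 ≤ s) :
    heatKernel s x = ‖x‖ ^ (-(d : ℤ)) * scaledKernel d (‖x‖ ^ (-2 : ℤ) * s) := by
  have hd' : (d : ℝ) ≠ 0 := by positivity
  rcases hs.eq_or_lt with rfl | hs
  · simp [scaledKernel_zero hd, heatKernel, Real.zero_rpow, hd']
  · have h1 : (‖x‖ ^ (-2 : ℤ) * s)⁻¹ = ‖x‖ ^ 2 * s⁻¹ := by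
      rw [mul_inv, zpow_neg, inv_inv]; norm_cast
    have h2 : (‖x‖ ^ 2 * s⁻¹) ^ ((d : ℝ) / 2) = ‖x‖ ^ d * s ^ (-(d : ℝ) / 2) := by
      rw [Real.mul_rpow (by positivity) (by positivity), Real.inv_rpow hs.le,
        ← Real.rpow_neg hs.le, neg_div, ← Real.rpow_natCast ‖x‖ 2, ← Real.rpow_mul hx.le]
      congr 1
      rw [show ((2 : ℕ) : ℝ) * ((d : ℝ) / 2) = d by push_cast; ring, Real.rpow_natCast]
    have h3 : -(‖x‖ ^ 2 * s⁻¹) / 4 = -‖x‖ ^ 2 / (4 * s) := by field_simp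
    rw [heatKernel, scaledKernel, h1, h2, h3, Real.mul_rpow (by positivity) hs.le, zpow_neg,
      zpow_natCast]
    field_simp

section Density

variable {d : ℕ} {Ω : Type*} [MeasurableSpace Ω] {P : Measure Ω} [IsProbabilityMeasure P]
  {T : ℝ≥0 → Ω → ℝ≥0} {φ : ℝ → ℝ}

theorem transitionDensity_eq {μ : Measure Ω} (hd : 1 ≤ d) (hT : ∀ t, Measurable (T t)) (t : ℝ≥0)
    {x : EuclideanSpace ℝ (Fin d)} (hx : 0 < ‖x‖) :
    transitionDensity T μ t x =
      ‖x‖ ^ (-(d : ℤ)) * ∫ ω, scaledKernel d (‖x‖ ^ (-2 : ℤ) * (T t ω : ℝ)) ∂μ := by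
  -- The kernel takes the default value 0 at time 0, so an atom of T_t at 0 contributes nothing and
  -- the integral may run over all of Ω.
  have h0 : heatKernel ((0 : ℝ≥0) : ℝ) x = 0 := by
    rw [NNReal.coe_zero, heatKernel_eq_scaledKernel hd hx le_rfl]
    simp [scaledKernel_zero hd]
  have hm : Measurable fun s : ℝ≥0 => heatKernel (s : ℝ) x := by unfold heatKernel; fun_prop
  rw [transitionDensity, setIntegral_eq_integral_of_forall_compl_eq_zero,
    integral_map (hT t).aemeasurable hm.aestronglyMeasurable, ← integral_const_mul]
  · exact integral_congr_ae (Eventually.of_forall fun ω =>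
      heatKernel_eq_scaledKernel hd hx (T t ω).2)
  · intro s hs
    rw [show s = 0 by simpa using hs, h0]

/-- The law of `l * S`, divided by `n`. -/
noncomputable def normalizedLaw (P : Measure Ω) (S : Ω → ℝ≥0) (n l : ℝ) : Measure ℝ :=
  ENNReal.ofReal n⁻¹ • P.map fun ω => l * (S ω : ℝ)

instance (S : Ω → ℝ≥0) (n l : ℝ) : IsFiniteMeasure (normalizedLaw P S n l) := by
  unfold normalizedLaw
  exact Measure.smul_finite _ ENNReal.ofReal_ne_top

theorem integral_normalizedLaw {μ : Measure Ω} {S : Ω → ℝ≥0} (hS : Measurable S)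
    {n : ℝ} (hn : 0 < n) (l : ℝ)
    {f : ℝ → ℝ} (hf : Measurable f) :
    ∫ u, f u ∂normalizedLaw μ S n l = n⁻¹ * ∫ ω, f (l * (S ω : ℝ)) ∂μ := by
  rw [normalizedLaw, integral_smul_measure, ENNReal.toReal_ofReal (inv_nonneg.2 hn.le),
    integral_map (by fun_prop) hf.aestronglyMeasurable, smul_eq_mul]

theorem normalizedLaw_nonneg {μ : Measure Ω} {S : Ω → ℝ≥0} (hS : Measurable S)
    (n : ℝ) {l : ℝ} (hl : 0 ≤ l) :
    ∀ᵐ u ∂normalizedLaw μ S n l, 0 ≤ u := by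
  refine Measure.ae_smul_measure ?_ _
  rw [ae_map_iff (by fun_prop) measurableSet_Ici]
  exact Eventually.of_forall fun ω => by positivity

variable {l : Filter (ℝ≥0 × EuclideanSpace ℝ (Fin d))} {γ : ℝ}

theorem tendsto_transitionDensity_div (hd : 1 ≤ d) (hT : ∀ t, Measurable (T t)) {κ : ℝ}
    {N : ℝ → ℝ} (hN : ∀ a, 0 < a → 0 < N a)
    (hl : ∀ᶠ q in l, 0 < q.1 ∧ 0 < ‖q.2‖) (hκ : 0 ≤ κ) (hγ : 0 ≤ γ) (hγ2 : γ < 2)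
    (hlim : ∀ c, 0 < c → Tendsto (fun q => ∫ u, expRemainder (c * u)
      ∂normalizedLaw P (T q.1) (q.1 * N (‖q.2‖ ^ (-2 : ℤ))) (‖q.2‖ ^ (-2 : ℤ))) l
        (𝓝 (κ * c ^ γ))) :
    Tendsto (fun q : ℝ≥0 × EuclideanSpace ℝ (Fin d) => transitionDensity T P q.1 q.2 /
      ((q.1 : ℝ) * ‖q.2‖ ^ (-(d : ℤ)) * N (‖q.2‖ ^ (-2 : ℤ)))) l
      (𝓝 (κ * γ / Real.Gamma (2 - γ) *
        (4 ^ γ * Real.pi ^ (-(d : ℝ) / 2) * Real.Gamma ((d : ℝ) / 2 + γ)))) := by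
  refine (tendsto_integral_scaledKernel hd
    (fun q => normalizedLaw_nonneg (hT _) _ (by positivity)) hκ hγ hγ2 hlim).congr' ?_
  filter_upwards [hl] with q hq
  have h1 : 0 < ‖q.2‖ ^ (-2 : ℤ) := zpow_pos hq.2 _
  have h2 : (0 : ℝ) < q.1 := hq.1
  have h3 := hN _ h1
  have h4 : 0 < ‖q.2‖ ^ (-(d : ℤ)) := zpow_pos hq.2 _
  rw [integral_normalizedLaw (hT _) (by positivity) _ (by fun_prop),
    transitionDensity_eq hd hT _ hq.2]
  field_simp

theorem tendsto_transitionDensity_div_exponent (hd : 1 ≤ d) (hT : ∀ t, Measurable (T t))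
    (hφ : IsLaplaceExponent φ T P) {b : Filter ℝ} (hreg : VariesRegularly φ b γ)
    (hl : ∀ᶠ q in l, 0 < q.1 ∧ 0 < ‖q.2‖)
    (hlb : Tendsto (fun q => ‖q.2‖ ^ (-2 : ℤ)) l b)
    (hl0 : Tendsto (fun q => (q.1 : ℝ) * φ (‖q.2‖ ^ (-2 : ℤ))) l (𝓝 0))
    (hγ : 0 ≤ γ) (hγ1 : γ < 1) :
    Tendsto (fun q : ℝ≥0 × EuclideanSpace ℝ (Fin d) => transitionDensity T P q.1 q.2 /
      ((q.1 : ℝ) * ‖q.2‖ ^ (-(d : ℤ)) * φ (‖q.2‖ ^ (-2 : ℤ)))) l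
      (𝓝 (γ * 4 ^ γ * Real.pi ^ (-(d : ℝ) / 2) *
        (Real.Gamma ((d : ℝ) / 2 + γ) / Real.Gamma (1 - γ)))) := by
  have h1γ : 0 < 1 - γ := by linarith
  have hΓ : Real.Gamma (2 - γ) = (1 - γ) * Real.Gamma (1 - γ) := by
    rw [← Real.Gamma_add_one h1γ.ne']; congr 1; ring
  refine (tendsto_transitionDensity_div hd hT (κ := 1 - γ) hreg.1 hl h1γ.le hγ (by linarith)
    fun c hc => tendsto_integral_expRemainder
      (fun q => normalizedLaw_nonneg (hT _) _ (by positivity)) (fun c hc => ?_) hc).trans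
      (le_of_eq (congrArg 𝓝 ?_))
  -- With y = tφ(cλ), the integral is (1 - e^{-y})/(tφ(λ)), squeezed by y(1-y) ≤ 1 - e^{-y} ≤ y.
  · have h1 := (hreg.2 c hc).comp hlb
    have h2 := hl0.mul h1
    rw [zero_mul] at h2
    have h3 := h1.mul (h2.const_sub 1)
    rw [sub_zero, mul_one] at h3
    refine tendsto_of_tendsto_of_tendsto_of_le_of_le' h3 h1 ?_ ?_
    all_goals
      filter_upwards [hl] with q hq
      have hlam : 0 < ‖q.2‖ ^ (-2 : ℤ) := zpow_pos hq.2 _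
      have ht : (0 : ℝ) < q.1 := hq.1
      have hp1 := (hφ _ hlam).1
      have hp2 := (hφ _ (mul_pos hc hlam)).1
      have hI : ∫ ω, (1 - Real.exp (-(c * (‖q.2‖ ^ (-2 : ℤ) * (T q.1 ω : ℝ))))) ∂P =
          1 - Real.exp (-(q.1 * φ (c * ‖q.2‖ ^ (-2 : ℤ)))) := by
        have h5 : ∀ ω, Real.exp (-(c * (‖q.2‖ ^ (-2 : ℤ) * (T q.1 ω : ℝ)))) =
            Real.exp (-(c * ‖q.2‖ ^ (-2 : ℤ)) * (T q.1 ω : ℝ)) := fun ω => by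
          congr 1; ring
        simp_rw [h5]
        rw [integral_sub (integrable_const _)
          (integrable_exp_neg_mul (hT _) (mul_pos hc hlam)), (hφ _ (mul_pos hc hlam)).2,
          neg_mul]
        simp
      rw [integral_normalizedLaw (hT _) (by positivity) _ (by fun_prop), hI]
      simp only [Function.comp]
      set lam := ‖q.2‖ ^ (-2 : ℤ)
      set y := (q.1 : ℝ) * φ (c * lam) with hy
      have hy0 : 0 < y := by positivity
      have hyy : (q.1 : ℝ) * φ lam * (φ (c * lam) / φ lam) = y := by rw [hy]; field_simp
      have hyy' : φ (c * lam) / φ lam = (q.1 * φ lam)⁻¹ * y := by rw [hy]; field_simp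
    · rw [hyy, hyy', mul_assoc]
      refine mul_le_mul_of_nonneg_left ?_ (by positivity)
      -- Nonnegativity of `expRemainder y` gives 1 - e^{-y} ≥ y e^{-y}, and e^{-y} ≥ 1 - y then
      -- gives y(1-y).
      have h6 := Real.add_one_le_exp y
      have h7 : Real.exp (-y) * Real.exp y = 1 := by rw [← Real.exp_add]; simp
      have h8 := Real.exp_pos (-y)
      have := expRemainder_nonneg y
      have := expRemainder_le_sq hy0.le
      have h9 := Real.add_one_le_exp (-y)
      unfold expRemainder at *
      nlinarith
    · rw [hyy']
      refine mul_le_mul_of_nonneg_left ?_ (by positivity)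
      linarith [Real.add_one_le_exp (-y)]
  · rw [hΓ]; field_simp

theorem tendsto_transitionDensity_div_lowerFunction (hd : 1 ≤ d) (hT : ∀ t, Measurable (T t))
    (hφ : IsLaplaceExponent φ T P) {b : Filter ℝ} (hreg : VariesRegularly (lowerFunction φ) b γ)
    (hl : ∀ᶠ q in l, 0 < q.1 ∧ 0 < ‖q.2‖)
    (hlb : Tendsto (fun q => ‖q.2‖ ^ (-2 : ℤ)) l b)
    (hl0 : Tendsto (fun q => (q.1 : ℝ) * φ (‖q.2‖ ^ (-2 : ℤ)) ^ 2 /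
      lowerFunction φ (‖q.2‖ ^ (-2 : ℤ))) l (𝓝 0))
    (hγ : 0 ≤ γ) (hγ2 : γ < 2) :
    Tendsto (fun q : ℝ≥0 × EuclideanSpace ℝ (Fin d) => transitionDensity T P q.1 q.2 /
      ((q.1 : ℝ) * ‖q.2‖ ^ (-(d : ℤ)) * lowerFunction φ (‖q.2‖ ^ (-2 : ℤ)))) l
      (𝓝 (γ * 4 ^ γ * Real.pi ^ (-(d : ℝ) / 2) *
        (Real.Gamma ((d : ℝ) / 2 + γ) / Real.Gamma (2 - γ)))) := by
  refine (tendsto_transitionDensity_div hd hT (κ := 1) hreg.1 hl zero_le_one hγ hγ2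
    fun c hc => ?_).trans (le_of_eq (congrArg 𝓝 (by ring)))
  rw [one_mul]
  have h1 := (hreg.2 c hc).comp hlb
  set C := max 1 c with hC
  have hC1 : 1 ≤ C := le_max_left _ _
  have h2 := hl0.const_mul C
  have h3 := hl0.const_mul (C ^ 2)
  rw [mul_zero] at h2 h3
  have h4 := h1.mul (h2.const_sub 1)
  rw [sub_zero, mul_one] at h4
  have h5 := h3.add h1
  rw [zero_add] at h5
  refine tendsto_of_tendsto_of_tendsto_of_le_of_le' h4 h5 ?_ ?_
  all_goals
    filter_upwards [hl] with q hq
    have hlam : 0 < ‖q.2‖ ^ (-2 : ℤ) := zpow_pos hq.2 _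
    have ht : (0 : ℝ) < q.1 := hq.1
    have hI : ∫ ω, expRemainder (c * (‖q.2‖ ^ (-2 : ℤ) * (T q.1 ω : ℝ))) ∂P =
        expRemainder (q.1 * φ (c * ‖q.2‖ ^ (-2 : ℤ))) +
          q.1 * lowerFunction φ (c * ‖q.2‖ ^ (-2 : ℤ)) *
            Real.exp (-(q.1 * φ (c * ‖q.2‖ ^ (-2 : ℤ)))) := by
      simp_rw [← mul_assoc]
      exact hφ.integral_expRemainder hT q.1 (mul_pos hc hlam)
    rw [integral_normalizedLaw (hT _) (mul_pos ht (hreg.1 _ hlam)) _ (by fun_prop), hI]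
    simp only [Function.comp]
    set lam := ‖q.2‖ ^ (-2 : ℤ)
    have hp1 := (hφ _ hlam).1
    have hp2 := (hφ _ (mul_pos hc hlam)).1
    have hle := hφ.lowerFunction_le hT hlam
    have hH1 := hreg.1 _ hlam
    have hH2 := hreg.1 _ (mul_pos hc hlam)
    have hmul := hφ.apply_mul_le hT hc hlam
    rw [← hC] at hmul
    set Hl := lowerFunction φ lam
    set Hc := lowerFunction φ (c * lam)
    set y := (q.1 : ℝ) * φ (c * lam) with hy
    have hy0 : 0 < y := by positivity
    have hyC : y ≤ C * (q.1 * φ lam) := by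
      rw [hy, mul_left_comm]; exact mul_le_mul_of_nonneg_left hmul ht.le
    have heq : ((q.1 : ℝ) * Hl)⁻¹ * (expRemainder y + q.1 * Hc * Real.exp (-y)) =
        expRemainder y / (q.1 * Hl) + Hc / Hl * Real.exp (-y) := by field_simp
    rw [heq]
  · have h6 : 0 ≤ expRemainder y / (q.1 * Hl) :=
      div_nonneg (expRemainder_nonneg y) (by positivity)
    -- As H ≤ φ, tφ is at most tφ²/H, so the assumed limit also forces tφ → 0 and the exponential
    -- factor tends to 1.
    have h7 : C * (q.1 * φ lam) ≤ C * (q.1 * φ lam ^ 2 / Hl) := by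
      refine mul_le_mul_of_nonneg_left ?_ (by positivity)
      rw [le_div_iff₀ hH1]
      nlinarith [mul_le_mul_of_nonneg_left hle (by positivity : 0 ≤ (q.1 : ℝ) * φ lam)]
    have h8 : 1 - C * (q.1 * φ lam ^ 2 / Hl) ≤ Real.exp (-y) := by
      linarith [Real.add_one_le_exp (-y)]
    have := mul_le_mul_of_nonneg_left h8 (by positivity : 0 ≤ Hc / Hl)
    linarith
  · have h6 : Real.exp (-y) ≤ 1 := Real.exp_le_one_iff.2 (by linarith)
    have h7 : Hc / Hl * Real.exp (-y) ≤ Hc / Hl := mul_le_of_le_one_right (by positivity) h6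
    -- The error r(y) ≤ y² divided by tH is of order tφ²/H, which is where this smallness condition
    -- comes from.
    have h8 : expRemainder y / (q.1 * Hl) ≤ C ^ 2 * (q.1 * φ lam ^ 2 / Hl) := by
      rw [div_le_iff₀ (by positivity)]
      calc _ ≤ y ^ 2 := expRemainder_le_sq hy0.le
        _ ≤ (C * (q.1 * φ lam)) ^ 2 := by gcongr
        _ = _ := by field_simp
    linarith

end Density

/-! ### The law of Brownian motion at an independent random time -/

section Subordination

variable {d : ℕ} {Ω : Type*} [MeasurableSpace Ω] {P : Measure Ω}
  {B : ℝ≥0 → Ω → EuclideanSpace ℝ (Fin d)}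

/-- Splitting along the values of S reduces the claim to independence of B at a fixed time from the
event {S = k}, so no joint measurability of B in time and ω is required. -/
theorem lintegral_comp_eq_of_indepFun (hB : ∀ t, Measurable (B t)) {S : Ω → ℕ}
    (hS : Measurable S) (hBS : IndepFun (fun ω t => B t ω) S P)
    (s : ℕ → ℝ≥0) {f : EuclideanSpace ℝ (Fin d) → ℝ≥0∞} (hf : Measurable f) :
    ∫⁻ ω, f (B (s (S ω)) ω) ∂P = ∫⁻ ω, ∫⁻ ω', f (B (s (S ω)) ω') ∂P ∂P := by
  have hsum : ∀ (h : ℕ → Ω → ℝ≥0∞) (ω : Ω),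
      h (S ω) ω = ∑' k, h k ω * ({k} : Set ℕ).indicator 1 (S ω) := fun h ω => by
    rw [tsum_eq_single (S ω)]
    · simp
    · intro k hk; simp [Ne.symm hk]
  have hind : ∀ k : ℕ, Measurable fun n : ℕ => ({k} : Set ℕ).indicator (1 : ℕ → ℝ≥0∞) n :=
    fun k => measurable_from_nat
  rw [lintegral_congr (hsum fun k ω => f (B (s k) ω)),
    lintegral_congr (hsum fun k _ => ∫⁻ ω', f (B (s k) ω') ∂P),
    lintegral_tsum (f := fun k ω => f (B (s k) ω) * ({k} : Set ℕ).indicator 1 (S ω))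
      fun k => ((hf.comp (hB _)).mul ((hind k).comp hS)).aemeasurable,
    lintegral_tsum (f := fun k ω =>
      (∫⁻ ω', f (B (s k) ω') ∂P) * ({k} : Set ℕ).indicator 1 (S ω))
      fun k => (((hind k).comp hS).const_mul _).aemeasurable]
  congr 1; ext k
  rw [lintegral_const_mul (f := fun ω => ({k} : Set ℕ).indicator 1 (S ω)) _
    ((hind k).comp hS)]
  exact lintegral_mul_eq_lintegral_mul_lintegral_of_indepFun (hf.comp (hB _))
    ((hind k).comp hS) (hBS.comp (hf.comp (measurable_pi_apply (s k))) (hind k))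

theorem tendsto_floor_mul_div (a : ℝ≥0) :
    Tendsto (fun n : ℕ => ((⌊(a : ℝ) * n⌋₊ : ℕ) : ℝ≥0) / n) atTop (𝓝 a) := by
  rw [← NNReal.tendsto_coe]
  have := (tendsto_nat_floor_mul_div_atTop a.2).comp (tendsto_natCast_atTop_atTop (R := ℝ))
  refine this.congr fun n => ?_
  simp

theorem tendsto_comp_floor (hc : ∀ᵐ ω ∂P, Continuous fun t => B t ω) (τ : Ω → ℝ≥0) :
    ∀ᵐ ω ∂P, Tendsto (fun n : ℕ => B (((⌊(τ ω : ℝ) * n⌋₊ : ℕ) : ℝ≥0) / n) ω) atTop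
      (𝓝 (B (τ ω) ω)) := by
  filter_upwards [hc] with ω hω using (hω.tendsto _).comp (tendsto_floor_mul_div _)

theorem measurable_comp_nat (hB : ∀ t, Measurable (B t)) {S : Ω → ℕ} (hS : Measurable S)
    (s : ℕ → ℝ≥0) : Measurable fun ω => B (s (S ω)) ω := by
  have h : Measurable fun q : ℕ × Ω => B (s q.1) q.2 :=
    measurable_from_prod_countable_right fun k => hB (s k)
  exact h.comp (hS.prodMk measurable_id)

@[fun_prop]
theorem measurable_heatKernel :
    Measurable fun q : ℝ≥0 × EuclideanSpace ℝ (Fin d) => heatKernel (q.1 : ℝ) q.2 := by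
  unfold heatKernel; fun_prop

theorem heatKernel_nonneg {s : ℝ} (hs : 0 ≤ s) (x : EuclideanSpace ℝ (Fin d)) :
    0 ≤ heatKernel s x := by
  unfold heatKernel; positivity

theorem IsBrownianMotion.lintegral_comp (hB : IsBrownianMotion B P) {s : ℝ≥0} (hs : 0 < s)
    {f : EuclideanSpace ℝ (Fin d) → ℝ≥0∞} (hf : Measurable f) :
    ∫⁻ ω, f (B s ω) ∂P = ∫⁻ x, ENNReal.ofReal (heatKernel s x) * f x := by
  have h1 : P.map (B s) = volume.withDensity fun x => ENNReal.ofReal (heatKernel s x) := by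
    have h2 := hB.law 0 s hs
    rw [NNReal.coe_zero, sub_zero] at h2
    rw [← h2]
    refine Measure.map_congr ?_
    filter_upwards [hB.zero] with ω hω
    rw [hω, sub_zero]
  have hm : Measurable fun x : EuclideanSpace ℝ (Fin d) => heatKernel (s : ℝ) x := by
    unfold heatKernel; fun_prop
  rw [← lintegral_map hf (hB.measurable s), h1,
    lintegral_withDensity_eq_lintegral_mul _ hm.ennreal_ofReal hf]
  rfl

theorem aemeasurable_comp_time (hB : ∀ t, Measurable (B t))
    (hc : ∀ᵐ ω ∂P, Continuous fun t => B t ω) {τ : Ω → ℝ≥0} (hτ : Measurable τ) :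
    AEMeasurable (fun ω => B (τ ω) ω) P :=
  aemeasurable_of_tendsto_metrizable_ae atTop
    (fun n : ℕ => (measurable_comp_nat hB (S := fun ω => ⌊(τ ω : ℝ) * n⌋₊) (by fun_prop)
      fun k : ℕ => (k : ℝ≥0) / (n : ℝ≥0)).aemeasurable)
    (tendsto_comp_floor hc τ)

variable [IsProbabilityMeasure P]

theorem continuous_lintegral_comp (hB : ∀ t, Measurable (B t))
    (hc : ∀ᵐ ω ∂P, Continuous fun t => B t ω)
    (f : BoundedContinuousFunction (EuclideanSpace ℝ (Fin d)) ℝ≥0) :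
    Continuous fun s => ∫⁻ ω, (f (B s ω) : ℝ≥0∞) ∂P := by
  refine continuous_iff_seqContinuous.2 fun u s hu => ?_
  refine tendsto_lintegral_of_dominated_convergence (fun _ => (nndist f 0 : ℝ≥0∞)) (fun n => ?_)
    (fun n => Eventually.of_forall fun ω => ?_) (by simp) ?_
  · have := hB (u n)
    have := f.continuous.measurable
    fun_prop
  · exact ENNReal.coe_le_coe.2 (BoundedContinuousFunction.NNReal.upper_bound f _)
  · filter_upwards [hc] with ω hω
    exact ENNReal.tendsto_coe.2 ((f.continuous.tendsto _).comp ((hω.tendsto s).comp hu))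

/-- The identity holds for the discretized times ⌊nτ⌋/n, which converge to τ. Path continuity and
boundedness of f give dominated convergence on both sides. -/
theorem lintegral_comp_time (hB : ∀ t, Measurable (B t))
    (hc : ∀ᵐ ω ∂P, Continuous fun t => B t ω) {τ : Ω → ℝ≥0} (hτ : Measurable τ)
    (hBτ : IndepFun (fun ω t => B t ω) τ P)
    (f : BoundedContinuousFunction (EuclideanSpace ℝ (Fin d)) ℝ≥0) :
    ∫⁻ ω, (f (B (τ ω) ω) : ℝ≥0∞) ∂P =
      ∫⁻ s, ∫⁻ ω, (f (B s ω) : ℝ≥0∞) ∂P ∂P.map τ := by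
  have hf := f.continuous.measurable
  have hg := continuous_lintegral_comp hB hc f
  set σ : ℕ → Ω → ℕ := fun n ω => ⌊(τ ω : ℝ) * n⌋₊ with hσ
  have hfl : ∀ n : ℕ, Measurable fun a : ℝ≥0 => ⌊(a : ℝ) * n⌋₊ := fun n => by fun_prop
  have hσm : ∀ n, Measurable (σ n) := fun n => (hfl n).comp hτ
  rw [lintegral_map hg.measurable hτ]
  have h1 : Tendsto (fun n : ℕ => ∫⁻ ω, (f (B ((σ n ω : ℝ≥0) / n) ω) : ℝ≥0∞) ∂P) atTop
      (𝓝 (∫⁻ ω, (f (B (τ ω) ω) : ℝ≥0∞) ∂P)) := by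
    refine tendsto_lintegral_of_dominated_convergence (fun _ => (nndist f 0 : ℝ≥0∞))
      (fun n => ?_) (fun n => Eventually.of_forall fun ω => ?_) (by simp) ?_
    · exact (hf.comp (measurable_comp_nat hB (hσm n)
        fun k => (k : ℝ≥0) / (n : ℝ≥0))).coe_nnreal_ennreal
    · exact ENNReal.coe_le_coe.2 (BoundedContinuousFunction.NNReal.upper_bound f _)
    · filter_upwards [tendsto_comp_floor hc τ] with ω hω
      exact ENNReal.tendsto_coe.2 ((f.continuous.tendsto _).comp hω)
  have h2 : Tendsto (fun n : ℕ => ∫⁻ ω, ∫⁻ ω', (f (B ((σ n ω : ℝ≥0) / n) ω') : ℝ≥0∞) ∂P ∂P)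
      atTop (𝓝 (∫⁻ ω, ∫⁻ ω', (f (B (τ ω) ω') : ℝ≥0∞) ∂P ∂P)) := by
    refine tendsto_lintegral_of_dominated_convergence (fun _ => (nndist f 0 : ℝ≥0∞))
      (fun n => ?_) (fun n => Eventually.of_forall fun ω => ?_) (by simp) ?_
    · exact (measurable_from_nat (f := fun k : ℕ =>
        ∫⁻ ω', (f (B ((k : ℝ≥0) / (n : ℝ≥0)) ω') : ℝ≥0∞) ∂P)).comp (hσm n)
    · refine (lintegral_mono fun ω' => ENNReal.coe_le_coe.2
        (BoundedContinuousFunction.NNReal.upper_bound f _)).trans ?_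
      simp
    · exact Eventually.of_forall fun ω => (hg.tendsto _).comp (tendsto_floor_mul_div _)
  refine tendsto_nhds_unique h1 (h2.congr fun n => ?_)
  exact (lintegral_comp_eq_of_indepFun hB (hσm n) (hBτ.comp measurable_id (hfl n))
    (fun k => (k : ℝ≥0) / (n : ℝ≥0)) (f := fun x => (f x : ℝ≥0∞)) hf.coe_nnreal_ennreal).symm

theorem ofReal_transitionDensity (hd : 1 ≤ d) {T : ℝ≥0 → Ω → ℝ≥0} (hT : ∀ t, Measurable (T t))
    (t : ℝ≥0) : (fun x : EuclideanSpace ℝ (Fin d) => ENNReal.ofReal (transitionDensity T P t x))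
      =ᵐ[volume] fun x => ∫⁻ s in Ioi 0, ENNReal.ofReal (heatKernel (s : ℝ) x) ∂P.map (T t) := by
  have : Nonempty (Fin d) := ⟨⟨0, hd⟩⟩
  obtain ⟨C, hC⟩ := exists_scaledKernel_le d
  have : IsProbabilityMeasure (P.map (T t)) :=
    Measure.isProbabilityMeasure_map (hT t).aemeasurable
  -- The origin is excluded because s ↦ (4πs)^{-d/2} need not be integrable there. Elsewhere the
  -- kernel is bounded in s.
  filter_upwards [Measure.ae_ne volume (0 : EuclideanSpace ℝ (Fin d))] with x hx
  have hx : 0 < ‖x‖ := norm_pos_iff.2 hx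
  have hm : Measurable fun s : ℝ≥0 => heatKernel (s : ℝ) x := by unfold heatKernel; fun_prop
  refine ofReal_integral_eq_lintegral_ofReal (Integrable.of_bound hm.aestronglyMeasurable
    (‖x‖ ^ (-(d : ℤ)) * C) (Eventually.of_forall fun s => ?_))
    (Eventually.of_forall fun s => heatKernel_nonneg s.coe_nonneg x)
  rw [Real.norm_of_nonneg (heatKernel_nonneg s.coe_nonneg x), heatKernel_eq_scaledKernel hd hx s.coe_nonneg]
  exact mul_le_mul_of_nonneg_left (hC _ (mul_nonneg (zpow_nonneg hx.le _) s.2))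
    (zpow_nonneg hx.le _)

theorem map_subordinate (hd : 1 ≤ d) (hB : IsBrownianMotion B P) {T : ℝ≥0 → Ω → ℝ≥0}
    (hT : ∀ t, Measurable (T t)) (hBT : IndepFun (fun ω t => B t ω) (fun ω t => T t ω) P)
    (t : ℝ≥0) :
    P.map (subordinate B T t) = P {ω | T t ω = 0} • Measure.dirac 0 +
      volume.withDensity fun x => ENNReal.ofReal (transitionDensity T P t x) := by
  have hX : AEMeasurable (subordinate B T t) P :=
    aemeasurable_comp_time hB.measurable hB.continuous_paths (hT t)
  have : IsProbabilityMeasure (P.map (subordinate B T t)) :=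
    Measure.isProbabilityMeasure_map hX
  have : IsProbabilityMeasure (P.map (T t)) :=
    Measure.isProbabilityMeasure_map (hT t).aemeasurable
  rw [withDensity_congr_ae (ofReal_transitionDensity hd hT t)]
  refine ext_of_forall_lintegral_eq_of_IsFiniteMeasure fun f => ?_
  have hf : Measurable fun x => (f x : ℝ≥0∞) := f.continuous.measurable.coe_nnreal_ennreal
  have hk : Measurable fun q : ℝ≥0 × EuclideanSpace ℝ (Fin d) =>
      ENNReal.ofReal (heatKernel (q.1 : ℝ) q.2) := by fun_prop
  have hz : ∫⁻ ω, (f (B 0 ω) : ℝ≥0∞) ∂P = f 0 := by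
    rw [lintegral_congr_ae (g := fun _ => (f 0 : ℝ≥0∞))]
    · simp
    · filter_upwards [hB.zero] with ω hω
      rw [hω]
  have hcompl : (Ioi (0 : ℝ≥0))ᶜ = {0} := by ext; simp
  have hmass : P.map (T t) {0} = P {ω | T t ω = 0} := by
    rw [Measure.map_apply (hT t) (measurableSet_singleton 0)]; rfl
  rw [lintegral_map' hf.aemeasurable hX, lintegral_add_measure, lintegral_smul_measure,
    lintegral_dirac' _ hf]
  rw [lintegral_withDensity_eq_lintegral_mul _ hk.lintegral_prod_left' hf]
  change ∫⁻ ω, (f (B (T t ω) ω) : ℝ≥0∞) ∂P = _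
  -- Splitting off s = 0 from the law of T_t produces the Dirac mass. On s > 0 the Gaussian density
  -- and Tonelli give the absolutely continuous part.
  rw [lintegral_comp_time hB.measurable hB.continuous_paths (hT t)
    (hBT.comp measurable_id (measurable_pi_apply t)) f,
    ← lintegral_add_compl _ (measurableSet_Ioi (a := (0 : ℝ≥0))), hcompl, lintegral_singleton,
    hz, hmass, add_comm, smul_eq_mul, mul_comm]
  congr 1
  have hs : ∀ s ∈ Ioi (0 : ℝ≥0), ∫⁻ ω, (f (B s ω) : ℝ≥0∞) ∂P =
      ∫⁻ x, ENNReal.ofReal (heatKernel (s : ℝ) x) * f x := fun s hs => hB.lintegral_comp hs hf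
  rw [setLIntegral_congr_fun measurableSet_Ioi hs, lintegral_lintegral_swap
    (hk.mul (hf.comp measurable_snd)).aemeasurable]
  refine lintegral_congr fun x => ?_
  have hkx : Measurable fun s : ℝ≥0 => ENNReal.ofReal (heatKernel (s : ℝ) x) :=
    hk.comp (measurable_id.prodMk measurable_const)
  rw [lintegral_mul_const _ hkx]
  rfl

end Subordination

/-! ### The joint limit filter, the reflection formula, and the theorem -/

theorem tendsto_jointLimit {d : ℕ} {a : Filter ℝ}
    {h : ℝ≥0 → EuclideanSpace ℝ (Fin d) → ℝ} :
    Tendsto (fun q : ℝ≥0 × EuclideanSpace ℝ (Fin d) => h q.1 q.2) (jointLimit a h) (𝓝 0) :=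
  tendsto_comap.mono_left (inf_le_left.trans inf_le_right)

theorem tendsto_norm_jointLimit {d : ℕ} {a : Filter ℝ}
    {h : ℝ≥0 → EuclideanSpace ℝ (Fin d) → ℝ} :
    Tendsto (fun q : ℝ≥0 × EuclideanSpace ℝ (Fin d) => ‖q.2‖) (jointLimit a h) a :=
  tendsto_comap.mono_left (inf_le_left.trans inf_le_left)

theorem eventually_pos_jointLimit {d : ℕ} {a : Filter ℝ} (ha : ∀ᶠ r in a, 0 < r)
    {h : ℝ≥0 → EuclideanSpace ℝ (Fin d) → ℝ} :
    ∀ᶠ q in jointLimit a h, 0 < q.1 ∧ 0 < ‖q.2‖ :=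
  Eventually.and (mem_inf_of_right
      (mem_principal_self {q : ℝ≥0 × EuclideanSpace ℝ (Fin d) | 0 < q.1}))
    (tendsto_norm_jointLimit.eventually ha)

theorem tendsto_zpow_neg_two_atTop : Tendsto (fun r : ℝ => r ^ (-2 : ℤ)) atTop (𝓝[>] 0) := by
  refine tendsto_nhdsWithin_iff.2 ⟨tendsto_zpow_atTop_zero (by norm_num), ?_⟩
  filter_upwards [eventually_gt_atTop 0] with r hr using zpow_pos hr _

theorem tendsto_zpow_neg_two_zero : Tendsto (fun r : ℝ => r ^ (-2 : ℤ)) (𝓝[>] 0) atTop := by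
  refine ((tendsto_pow_atTop two_ne_zero).comp tendsto_inv_nhdsGT_zero).congr fun r => ?_
  simp only [Function.comp, inv_pow, zpow_neg]
  norm_cast

theorem gamma_quotient_eq_sin {γ : ℝ} (hγ : 0 ≤ γ) (hγ1 : γ < 1) (s : ℝ) :
    γ * 4 ^ γ * Real.pi ^ (-s / 2) * (Real.Gamma (s / 2 + γ) / Real.Gamma (1 - γ)) =
      γ * 4 ^ γ * Real.pi ^ (-s / 2 - 1) * Real.sin (γ * Real.pi) * Real.Gamma γ *
        Real.Gamma (s / 2 + γ) := by
  rcases hγ.eq_or_lt with rfl | hγ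
  -- At γ = 0 both sides vanish because of the leading factor γ.
  · simp
  have hsin : 0 < Real.sin (γ * Real.pi) :=
    Real.sin_pos_of_pos_of_lt_pi (by positivity) (by nlinarith [Real.pi_pos])
  have h1 := Real.Gamma_mul_Gamma_one_sub γ
  have h2 : 0 < Real.Gamma (1 - γ) := Real.Gamma_pos_of_pos (by linarith)
  rw [mul_comm Real.pi, eq_div_iff hsin.ne'] at h1
  have h3 : Real.pi ^ (-s / 2) = Real.pi ^ (-s / 2 - 1) * Real.pi := by
    rw [Real.rpow_sub_one Real.pi_ne_zero]; field_simp
  rw [h3]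
  generalize Real.sin (γ * Real.pi) = z at *
  generalize Real.pi ^ (-s / 2 - 1) = y at *
  rw [← h1]
  field_simp

end SubordinateBM

theorem mainTheorem11 {d : ℕ} (hd : 1 ≤ d) {Ω : Type*} [MeasurableSpace Ω]
    (P : Measure Ω) [IsProbabilityMeasure P]
    (B : ℝ≥0 → Ω → EuclideanSpace ℝ (Fin d)) (hB : SubordinateBM.IsBrownianMotion B P)
    (T : ℝ≥0 → Ω → ℝ≥0) (hT : SubordinateBM.IsSubordinator T P)
    (hBT : IndepFun (fun ω t => B t ω) (fun ω t => T t ω) P)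
    (φ : ℝ → ℝ) (hφ : SubordinateBM.IsLaplaceExponent φ T P)
    (p : ℝ≥0 → EuclideanSpace ℝ (Fin d) → ℝ)
    (hp : p = SubordinateBM.transitionDensity T P)
    (H : ℝ → ℝ) (hH : H = SubordinateBM.lowerFunction φ) :
    -- `p(t, ·)` is the density of `X_t = B_{T_t}` (which has an atom at `0` if `P(T_t = 0) > 0`)
    (∀ t : ℝ≥0, 0 < t →
      AEMeasurable (SubordinateBM.subordinate B T t) P ∧
      P.map (SubordinateBM.subordinate B T t) =
        P {ω | T t ω = 0} • Measure.dirac 0 +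
          volume.withDensity (fun x => ENNReal.ofReal (p t x))) ∧
    -- (i)
    (∀ γ : ℝ, 0 ≤ γ → γ < 1 →
      (SubordinateBM.VariesRegularly φ (𝓝[>] 0) γ →
        Tendsto (fun q : ℝ≥0 × EuclideanSpace ℝ (Fin d) =>
            p q.1 q.2 / ((q.1 : ℝ) * ‖q.2‖ ^ (-(d : ℤ)) * φ (‖q.2‖ ^ (-2 : ℤ))))
          (SubordinateBM.jointLimit atTop fun t x => (t : ℝ) * φ (‖x‖ ^ (-2 : ℤ)))
          (𝓝 (γ * 4 ^ γ * Real.pi ^ (-(d : ℝ) / 2) *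
            (Real.Gamma ((d : ℝ) / 2 + γ) / Real.Gamma (1 - γ))))) ∧
      (SubordinateBM.VariesRegularly φ atTop γ →
        Tendsto (fun q : ℝ≥0 × EuclideanSpace ℝ (Fin d) =>
            p q.1 q.2 / ((q.1 : ℝ) * ‖q.2‖ ^ (-(d : ℤ)) * φ (‖q.2‖ ^ (-2 : ℤ))))
          (SubordinateBM.jointLimit (𝓝[>] 0) fun t x => (t : ℝ) * φ (‖x‖ ^ (-2 : ℤ)))
          (𝓝 (γ * 4 ^ γ * Real.pi ^ (-(d : ℝ) / 2) *
            (Real.Gamma ((d : ℝ) / 2 + γ) / Real.Gamma (1 - γ))))) ∧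
      γ * 4 ^ γ * Real.pi ^ (-(d : ℝ) / 2) *
          (Real.Gamma ((d : ℝ) / 2 + γ) / Real.Gamma (1 - γ)) =
        γ * 4 ^ γ * Real.pi ^ (-(d : ℝ) / 2 - 1) * Real.sin (γ * Real.pi) *
          Real.Gamma γ * Real.Gamma ((d : ℝ) / 2 + γ)) ∧
    -- (ii)
    (∀ γ : ℝ, 0 ≤ γ → γ < 2 →
      (SubordinateBM.VariesRegularly H (𝓝[>] 0) γ →
        Tendsto (fun q : ℝ≥0 × EuclideanSpace ℝ (Fin d) =>
            p q.1 q.2 / ((q.1 : ℝ) * ‖q.2‖ ^ (-(d : ℤ)) * H (‖q.2‖ ^ (-2 : ℤ))))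
          (SubordinateBM.jointLimit atTop fun t x =>
            (t : ℝ) * φ (‖x‖ ^ (-2 : ℤ)) ^ 2 / H (‖x‖ ^ (-2 : ℤ)))
          (𝓝 (γ * 4 ^ γ * Real.pi ^ (-(d : ℝ) / 2) *
            (Real.Gamma ((d : ℝ) / 2 + γ) / Real.Gamma (2 - γ))))) ∧
      (SubordinateBM.VariesRegularly H atTop γ →
        (γ < 1 → SubordinateBM.HasNoDrift φ) →
        Tendsto (fun q : ℝ≥0 × EuclideanSpace ℝ (Fin d) =>
            p q.1 q.2 / ((q.1 : ℝ) * ‖q.2‖ ^ (-(d : ℤ)) * H (‖q.2‖ ^ (-2 : ℤ))))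
          (SubordinateBM.jointLimit (𝓝[>] 0) fun t x =>
            (t : ℝ) * φ (‖x‖ ^ (-2 : ℤ)) ^ 2 / H (‖x‖ ^ (-2 : ℤ)))
          (𝓝 (γ * 4 ^ γ * Real.pi ^ (-(d : ℝ) / 2) *
            (Real.Gamma ((d : ℝ) / 2 + γ) / Real.Gamma (2 - γ)))))) := by
  subst hp hH
  have htop : ∀ᶠ r : ℝ in atTop, 0 < r := eventually_gt_atTop 0
  have hzero : ∀ᶠ r : ℝ in 𝓝[>] 0, 0 < r := self_mem_nhdsWithin
  refine ⟨fun t _ => ⟨SubordinateBM.aemeasurable_comp_time hB.measurable hB.continuous_paths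
    (hT.measurable t), SubordinateBM.map_subordinate hd hB hT.measurable hBT t⟩,
    fun γ hγ hγ1 => ⟨fun hreg => ?_, fun hreg => ?_,
      SubordinateBM.gamma_quotient_eq_sin hγ hγ1 d⟩,
    fun γ hγ hγ2 => ⟨fun hreg => ?_, fun hreg _ => ?_⟩⟩
  · exact SubordinateBM.tendsto_transitionDensity_div_exponent hd hT.measurable hφ hreg
      (SubordinateBM.eventually_pos_jointLimit htop)
      (SubordinateBM.tendsto_zpow_neg_two_atTop.comp SubordinateBM.tendsto_norm_jointLimit)
      SubordinateBM.tendsto_jointLimit hγ hγ1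
  · exact SubordinateBM.tendsto_transitionDensity_div_exponent hd hT.measurable hφ hreg
      (SubordinateBM.eventually_pos_jointLimit hzero)
      (SubordinateBM.tendsto_zpow_neg_two_zero.comp SubordinateBM.tendsto_norm_jointLimit)
      SubordinateBM.tendsto_jointLimit hγ hγ1
  · exact SubordinateBM.tendsto_transitionDensity_div_lowerFunction hd hT.measurable hφ hreg
      (SubordinateBM.eventually_pos_jointLimit htop)
      (SubordinateBM.tendsto_zpow_neg_two_atTop.comp SubordinateBM.tendsto_norm_jointLimit)
      SubordinateBM.tendsto_jointLimit hγ hγ2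
  · exact SubordinateBM.tendsto_transitionDensity_div_lowerFunction hd hT.measurable hφ hreg
      (SubordinateBM.eventually_pos_jointLimit hzero)
      (SubordinateBM.tendsto_zpow_neg_two_zero.comp SubordinateBM.tendsto_norm_jointLimit)
      SubordinateBM.tendsto_jointLimit hγ hγ2
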